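/- Let $k\ge 1$ be an integer. (a) There is exactly one polynomial $N_k(q,N_1)$ in two variables with integer coefficients such that, for every finite field $\mathbb{F}_q$, every elliptic curve $E$ over $\mathbb{F}_q$ and every extension $\mathbb{F}_{q^k}$ of $\mathbb{F}_q$ of degree $k$, $$\#E(\mathbb{F}_{q^k}) = N_k\bigl(q,\#E(\mathbb{F}_q)\bigr).$$ (b) For integers $q\ge 0$ and $t\ge 1$, let $W_k(q,t)$ be the directed multigraph with a hub vertex $v_0$ and rim vertices $v_i$ ($i\in\mathbb{Z}/k$, labelled clockwise), with $t$ edges from $v_0$ to each $v_i$, $t$ edges from each $v_i$ to $v_0$, one edge from each $v_i$ to $v_{i-1}$ and $q$ edges from each $v_i$ to $v_{i+1}$ (loops, which occur only for $k=1$, are disregarded). A configuration assigns to each vertex an integer number of chips, nonnegative at each vertex other than the bank $v_0$, with total $0$. A vertex fires by sending one chip along each of its outgoing edges; a vertex other than $v_0$ may fire if it holds at least as many chips as its out-degree, and $v_0$ may fire exactly when no other vertex can. A configuration is stable if only $v_0$ can fire, recurrent if some nonempty legal firing sequence leads from it back to itself, and critical if it is stable and recurrent. The critical group $K(W_k(q,t))$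 is the set of critical configurations, where the sum of two of them is the critical configuration reachable from their pointwise sum. Then $$\bigl|K(W_k(q,t))\bigr| = -N_k(q,-t),$$ where $N_k$ is the polynomial of (a). -/

import Mathlib

/-- A directed graph with multiple edges on the vertex set `V`: `G.d i j` is the number of edges
from `i` to `j`. -/
structure MultiDigraph (V : Type) where
  d : V → V → ℕ

namespace MultiDigraph

variable {V : Type} [Fintype V] [DecidableEq V]

/-- The out-degree of a vertex. Loops play no role in chip-firing and are not counted. -/
def outDegree (G : MultiDigraph V) (i : V) : ℕ :=
  ∑ j ∈ Finset.univ.erase i, G.d i j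

/-- The result of firing the vertex `i`: one chip travels along each edge leaving `i`. -/
def fire (G : MultiDigraph V) (i : V) (c : V → ℤ) : V → ℤ :=
  fun j => if j = i then c i - G.outDegree i else c j + G.d i j

/-- Configurations of the dollar game with bank `b`: every vertex other than the bank holds a
nonnegative number of chips, and the total number of chips is `0`. -/
def IsConfig (b : V) (c : V → ℤ) : Prop :=
  (∀ i, i ≠ b → 0 ≤ c i) ∧ ∑ i, c i = 0

/-- No vertex other than the bank holds enough chips to fire. -/
def IsStable (G : MultiDigraph V) (b : V) (c : V → ℤ) : Prop :=
  ∀ i, i ≠ b → c i < G.outDegree i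

/-- The vertices which may fire in the dollar game: a vertex other than the bank may fire if it
holds at least as many chips as its out-degree; the bank may fire, whatever it holds, if no other
vertex can fire. -/
def CanFire (G : MultiDigraph V) (b : V) (c : V → ℤ) (i : V) : Prop :=
  if i = b then G.IsStable b c else (G.outDegree i : ℤ) ≤ c i

/-- `c'` arises from `c` by one legal firing. -/
def Step (G : MultiDigraph V) (b : V) (c c' : V → ℤ) : Prop :=
  ∃ i, G.CanFire b c i ∧ c' = G.fire i c

/-- `c'` can be reached from `c` by a (possibly empty) legal firing sequence. -/
def Reaches (G : MultiDigraph V) (b : V) : (V → ℤ) → (V → ℤ) → Prop :=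
  Relation.ReflTransGen (G.Step b)

/-- Some nonempty legal firing sequence leads from `c` back to `c`. -/
def IsRecurrent (G : MultiDigraph V) (b : V) (c : V → ℤ) : Prop :=
  Relation.TransGen (G.Step b) c c

/-- Critical configurations: those that are stable and recurrent. -/
def IsCritical (G : MultiDigraph V) (b : V) (c : V → ℤ) : Prop :=
  IsConfig b c ∧ G.IsStable b c ∧ G.IsRecurrent b c

/-- The underlying set of the critical group of `G` with bank `b`: the critical configurations. -/
def CriticalGroup (G : MultiDigraph V) (b : V) : Type :=
  {c : V → ℤ // G.IsCritical b c}

open Classical in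
/-- Addition of critical configurations: `C₁ ⊕ C₂` is the critical configuration reachable from the
pointwise sum of `C₁` and `C₂`. -/
noncomputable instance (G : MultiDigraph V) (b : V) : Add (G.CriticalGroup b) where
  add C₁ C₂ :=
    if h : ∃ C : G.CriticalGroup b, G.Reaches b (C₁.1 + C₂.1) C.1 then h.choose else C₁

end MultiDigraph

/-- The `(q,t)`-wheel multidigraph with `k` rim vertices. The hub is `none`; the rim vertices
`some i` are labelled clockwise by `i` modulo `k`. There are `t` edges from the hub to each rim
vertex and `t` edges back; each rim vertex `i` has one (counter-clockwise) edge to `i - 1` and `q`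
(clockwise) edges to `i + 1`. -/
def wheel (k q t : ℕ) : MultiDigraph (Option (ZMod k)) where
  d
    | none, none => 0
    | none, some _ => t
    | some _, none => t
    | some i, some j => (if j = i - 1 then 1 else 0) + (if j = i + 1 then q else 0)

/-- The polynomial `N` with integer coefficients in two variables expresses the number of points of
elliptic curves over extensions of degree `k` of finite fields: for every finite field `F` with `q`
elements, every elliptic curve `E` over `F` and every extension `K` of `F` of degree `k`,
`#E(K) = N(q, #E(F))`. Points include the point at infinity. -/
def ExpressesPointCount (k : ℕ) (N : MvPolynomial (Fin 2) ℤ) : Prop :=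
  ∀ (F K : Type) [Field F] [Finite F] [Field K] [Algebra F K], Module.finrank F K = k →
    ∀ (E : WeierstrassCurve F) [E.IsElliptic],
      (Nat.card (E.baseChange K).toAffine.Point : ℤ) =
        MvPolynomial.eval ![(Nat.card F : ℤ), (Nat.card E.toAffine.Point : ℤ)] N

/-! Existence of `N_k` is the rationality of the zeta function in genus one, obtained by counting
ideals of the coordinate ring `R`. Smoothness makes `R` a Dedekind domain, and codimension over `F`
is additive on products of nonzero ideals. The functions with a pole of order at most `m` at
infinity form a space of dimension `m` for `m ≥ 1`. This yields Riemann-Roch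
(`finrank_infFiltration`): the elements of an ideal of codimension `d < m` with pole order at most
`m` form a space of dimension `m - d`. Double counting principal products then shows that the number
`a n` of ideals of codimension `n` is `(1 + a 1) * q ^ (n - 1)` for `n ≥ 2` (`ncard_ofCodim`).

The Euler product (`mul_ncard_ofCodim`) expresses `n * a n` through sums of degrees of primes, and
those sums count the affine points over extensions (`card_algHom`). Solving the recursion gives
`#E(K) = 1 + q ^ k - (α ^ k + β ^ k)` with `α + β = 1 + q - #E(F)` and `α * β = q`.

For uniqueness one curve suffices: over the field with two elements it has two points, and `α`, `β`
are multiplicatively independent. Its base changes give a sequence of points at which the difference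
of two candidates vanishes, and independence of characters forces this difference to be zero.

On the graph side, critical configurations represent the classes of `ℤ ^ k` modulo the rows of the
reduced Laplacian, so their number is the absolute value of its determinant (`card_isCrit`). For the
wheel the Laplacian is circulant; up to an invertible factor it is `(α - P) * (β - P)`, where `P` is
the cyclic shift, now with `α + β = 1 + q + t` and `α * β = q`. Its determinant `α ^ k + β ^ k - 1 -
q ^ k` is the point count formula at `N₁ = -t`, negated. -/

/-! ### Dedekind domains from invertible maximal ideals. -/

section InvertibleMaximal

variable {A : Type*} [CommRing A] [IsDomain A]

open nonZeroDivisors in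
/-- A Noetherian domain all of whose maximal ideals are invertible is a Dedekind domain. -/
theorem isDedekindDomain_of_forall_isMaximal_invertible [IsNoetherianRing A]
    (h : ∀ P : Ideal A, P.IsMaximal → ∃ (Q : Ideal A) (p : A), p ≠ 0 ∧ P * Q = Ideal.span {p}) :
    IsDedekindDomain A := by
  have key : ∀ J : Ideal A, J ≠ ⊥ →
      ∃ (J' : Ideal A) (c : A), c ≠ 0 ∧ J * J' = Ideal.span {c} := by
    intro J
    induction J using WellFoundedGT.induction with
    | ind J ih =>
      intro hJ
      by_cases hJt : J = ⊤
      · exact ⟨⊤, 1, one_ne_zero, by simp [hJt]⟩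
      obtain ⟨P, hP, hJP⟩ := Ideal.exists_le_maximal J hJt
      obtain ⟨Q, p, hp, hPQ⟩ := h P hP
      have hle : J * Q ≤ Ideal.span {p} := hPQ ▸ Ideal.mul_mono_left hJP
      -- `J₁` plays the role of `J * P⁻¹`, since `Q` divided by `p` is the inverse of `P`.
      obtain ⟨J₁, hJ₁⟩ : ∃ J₁, J * Q = Ideal.span {p} * J₁ := by
        refine ⟨Submodule.comap (LinearMap.mulLeft A p) (J * Q), ?_⟩
        rw [Ideal.eq_span_singleton_mul]
        refine ⟨fun x hx ↦ ?_, fun z hz ↦ hz⟩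
        obtain ⟨z, rfl⟩ := Ideal.mem_span_singleton.1 (hle hx)
        exact ⟨z, hx, rfl⟩
      have hspan : Ideal.span {p} ≠ (⊥ : Ideal A) := by simpa using hp
      have hJ₁P : J₁ * P = J := by
        refine (Ideal.span_singleton_mul_right_inj hp).1 ?_
        rw [← mul_assoc, ← hJ₁, mul_assoc, mul_comm Q, hPQ, mul_comm]
      -- If `J = J₁` then `J = J * P`, and Nakayama yields `r ≡ 1` modulo `P` annihilating `J`; in a
      -- domain `r = 0`, so `1 ∈ P`.
      have hlt : J < J₁ := by
        refine lt_of_le_of_ne (hJ₁P.symm.trans_le Ideal.mul_le_left) fun heq ↦ ?_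
        obtain ⟨r, hr, hr'⟩ := Submodule.exists_sub_one_mem_and_smul_eq_zero_of_fg_of_le_smul P J
          (IsNoetherian.noetherian J) (by
            rw [smul_eq_mul, mul_comm]
            exact le_of_eq (by rw [← heq] at hJ₁P; exact hJ₁P.symm))
        obtain ⟨x, hx, hx0⟩ := Submodule.exists_mem_ne_zero_of_ne_bot hJ
        have hr0 : r = 0 := by simpa [hx0] using hr' x hx
        exact hP.ne_top (P.eq_top_iff_one.2 (by simpa [hr0] using hr))
      obtain ⟨J', c, hc, hJ'⟩ := ih J₁ hlt (ne_bot_of_gt hlt)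
      refine ⟨Q * J', p * c, mul_ne_zero hp hc, ?_⟩
      rw [← Ideal.span_singleton_mul_span_singleton, ← hJ', ← hPQ]
      conv_lhs => rw [← hJ₁P]
      ring
  rw [isDedekindDomain_iff_mul_inv_cancel (K := FractionRing A)]
  intro I hI
  obtain ⟨a, J, ha, rfl⟩ := FractionalIdeal.exists_eq_spanSingleton_mul (K := FractionRing A) I
  have hJ : J ≠ ⊥ := by
    rintro rfl
    simp at hI
  obtain ⟨J', c, hc, hJ'⟩ := key J hJ
  have hc' : algebraMap A (FractionRing A) c ≠ 0 := by simpa using hc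
  have ha' : algebraMap A (FractionRing A) a ≠ 0 := by simpa using ha
  rw [FractionalIdeal.mul_inv_cancel_iff]
  refine ⟨FractionalIdeal.spanSingleton A⁰ (algebraMap A _ a * (algebraMap A _ c)⁻¹) *
    (J' : FractionalIdeal A⁰ (FractionRing A)), ?_⟩
  rw [mul_mul_mul_comm, ← FractionalIdeal.coeIdeal_mul, hJ', FractionalIdeal.coeIdeal_span_singleton,
    FractionalIdeal.spanSingleton_mul_spanSingleton,
    FractionalIdeal.spanSingleton_mul_spanSingleton, ← FractionalIdeal.spanSingleton_one]
  congr 1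
  field_simp

end InvertibleMaximal

/-! ### The coordinate ring of an elliptic curve is Dedekind. -/

namespace WeierstrassCurve.Affine.CoordinateRing

open Polynomial
open scoped Polynomial.Bivariate

variable {F : Type*} [Field F] (W : Affine F)

instance : Module.Finite F[X] W.CoordinateRing := .of_basis (CoordinateRing.basis W)

instance : IsNoetherianRing W.CoordinateRing :=
  .of_finite F[X] W.CoordinateRing

/-- The value of the Weierstrass polynomial at a polynomial in place of `Y`. -/
noncomputable def evalY (g : F[X]) : F[X] :=
  g ^ 2 + (C W.a₁ * X + C W.a₃) * g - (X ^ 3 + C W.a₂ * X ^ 2 + C W.a₄ * X + C W.a₆)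

variable {W}

/-- The second factor is minus the conjugate of the first under `y ↦ -y - a₁ x - a₃`, so the product
is minus a norm. -/
lemma sub_mul_add_eq (g : F[X]) :
    (mk W Y - algebraMap F[X] _ g) * (mk W Y + algebraMap F[X] _ (g + (C W.a₁ * X + C W.a₃))) =
      -algebraMap F[X] _ (evalY W g) := by
  have h : ∀ f : F[X], algebraMap F[X] W.CoordinateRing f = mk W (C f) := fun f ↦ rfl
  rw [h, h, h, ← map_sub, ← map_add, ← map_mul, ← map_neg]
  refine AdjoinRoot.mk_eq_mk.mpr ⟨1, ?_⟩
  rw [evalY, Affine.polynomial]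
  simp only [C_add, C_mul, C_sub, C_pow]
  ring1

lemma derivative_evalY (g : F[X]) :
    derivative (evalY W g) = (2 * g + (C W.a₁ * X + C W.a₃)) * derivative g +
      (C W.a₁ * g - (3 * X ^ 2 + 2 * C W.a₂ * X + C W.a₄)) := by
  simp only [evalY, derivative_sub, derivative_add, derivative_mul, derivative_pow, derivative_X,
    derivative_C, map_ofNat, Nat.cast_ofNat]
  ring

/-- This is where smoothness enters. Over the field `F[X]/(p)` the pair (root of `p`, `g`) is a
point of the curve. Were the divisibility to hold, the partial derivative in `y` would vanish there,
and differentiating `evalY W g` would make the other one vanish too. -/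
lemma not_dvd_of_sq_dvd_evalY [W.IsElliptic] {p g : F[X]} (hp : Irreducible p)
    (h : p ^ 2 ∣ evalY W g) : ¬ p ∣ 2 * g + (C W.a₁ * X + C W.a₃) := by
  intro hs
  have : Fact (Irreducible p) := ⟨hp⟩
  have hd : p ∣ derivative (evalY W g) := by
    obtain ⟨m, hm⟩ := h
    rw [hm, derivative_mul, derivative_pow]
    refine dvd_add (Dvd.dvd.mul_right (Dvd.dvd.mul_right ?_ _) _) ((dvd_pow_self p two_ne_zero).mul_right _)
    simp
  rw [derivative_evalY, dvd_add_right (hs.mul_right _)] at hd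
  have h0 : p ∣ evalY W g := (dvd_pow_self p two_ne_zero).trans h
  have hE : (W.map (algebraMap F (AdjoinRoot p))).toAffine.Equation (AdjoinRoot.root p)
      (AdjoinRoot.mk p g) := by
    rw [← AdjoinRoot.mk_eq_zero, evalY] at h0
    simp only [map_sub, map_add, map_mul, map_pow, AdjoinRoot.mk_X, AdjoinRoot.mk_C] at h0
    rw [equation_iff', ← h0]
    simp only [map_a₁, map_a₂, map_a₃, map_a₄, map_a₆, AdjoinRoot.algebraMap_eq]
    ring
  rw [equation_iff_nonsingular, nonsingular_iff'] at hE
  rw [← AdjoinRoot.mk_eq_zero] at hd hs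
  simp only [map_sub, map_add, map_mul, map_pow, AdjoinRoot.mk_X, AdjoinRoot.mk_C, map_ofNat] at hd hs
  simp only [map_a₁, map_a₂, map_a₃, map_a₄, AdjoinRoot.algebraMap_eq] at hE
  rcases hE.2 with h | h
  · exact h hd
  · exact h (by rw [← hs]; ring)

/-- Let `p` generate the contraction of `P` to `F[X]`. Either `p` is inert and `P = (p)`, or `P =
(p, y - g)`, whose product with the conjugate ideal is `(p)`. -/
lemma exists_mul_eq_span_of_isMaximal [W.IsElliptic] (P : Ideal W.CoordinateRing) (hP : P.IsMaximal) :
    ∃ (Q : Ideal W.CoordinateRing) (p : W.CoordinateRing), p ≠ 0 ∧ P * Q = Ideal.span {p} := by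
  set ι := algebraMap F[X] W.CoordinateRing with hι
  have hιinj : Function.Injective ι := FaithfulSMul.algebraMap_injective _ _
  have hmax : (P.comap ι).IsMaximal := Ideal.isMaximal_comap_of_isIntegral_of_isMaximal P
  obtain ⟨p, hp⟩ := IsPrincipalIdealRing.principal (P.comap ι)
  have hp0 : p ≠ 0 := by
    rintro rfl
    refine Ring.ne_bot_of_isMaximal_of_not_isField hmax (Polynomial.not_isField F) ?_
    rw [hp]; simp
  have hpirr : Irreducible p := by
    refine ((Ideal.span_singleton_prime hp0).1 ?_).irreducible
    have := hmax.isPrime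
    rwa [hp] at this
  have hmem : ∀ f, ι f ∈ P ↔ p ∣ f := fun f ↦ by
    rw [← Ideal.mem_span_singleton, ← Ideal.mem_comap, hp]
  have hι0 : ι p ≠ 0 := by simpa using hιinj.ne hp0
  by_cases hall : ∀ a b : F[X], ι a + ι b * mk W Y ∈ P → p ∣ b
  · refine ⟨⊤, ι p, hι0, ?_⟩
    rw [Ideal.mul_top]
    apply le_antisymm
    · intro f hf
      obtain ⟨a, b, rfl⟩ := exists_smul_basis_eq f
      rw [Algebra.smul_def, Algebra.smul_def, mul_one] at hf ⊢
      have hb := hall a b hf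
      have ha : p ∣ a := by
        rw [← hmem]
        exact (P.add_mem_iff_left (P.mul_mem_right _ ((hmem b).2 hb))).1 hf
      rw [Ideal.mem_span_singleton]
      exact dvd_add (map_dvd ι ha) ((map_dvd ι hb).mul_right _)
    · rw [Ideal.span_singleton_le_iff_mem, hmem]
  · push Not at hall
    obtain ⟨a, b, hab, hb⟩ := hall
    -- As `b` is invertible modulo `p`, the relation `a + b y ∈ P` can be solved for `y` modulo `P`.
    obtain ⟨c, d, hcd⟩ : IsCoprime b p := ((hpirr.coprime_iff_not_dvd).2 hb).symm
    obtain ⟨g, hg⟩ : ∃ g, mk W Y - ι g ∈ P := by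
      refine ⟨-(c * a), ?_⟩
      have h1 : ι c * (ι a + ι b * mk W Y) + ι p * (ι d * mk W Y) ∈ P :=
        P.add_mem (P.mul_mem_left _ hab) (P.mul_mem_right _ ((hmem p).2 dvd_rfl))
      convert h1 using 1
      have h2 := congr_arg ι hcd
      simp only [map_add, map_mul, map_one, map_neg] at h2 ⊢
      linear_combination -mk W Y * h2
    have hPeq : P = Ideal.span {ι p, mk W Y - ι g} := by
      apply le_antisymm
      · intro f hf
        obtain ⟨a, b, rfl⟩ := exists_smul_basis_eq f
        rw [Algebra.smul_def, Algebra.smul_def, mul_one] at hf ⊢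
        have h1 : p ∣ a + b * g := by
          rw [← hmem]
          have := P.sub_mem hf (P.mul_mem_left (ι b) hg)
          convert this using 1
          simp only [map_add, map_mul]
          ring
        obtain ⟨e, he⟩ := h1
        rw [Ideal.mem_span_pair]
        refine ⟨ι e, ι b, ?_⟩
        have h2 := congr_arg ι he
        simp only [map_add, map_mul] at h2
        linear_combination -h2
      · rw [Ideal.span_le]
        rintro x (rfl | rfl)
        · exact (hmem p).2 dvd_rfl
        · exact hg
    have hfac := sub_mul_add_eq (W := W) g
    rw [← hι] at hfac
    obtain ⟨m, hm⟩ : p ∣ evalY W g := by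
      rw [← hmem, ← neg_mem_iff, ← hfac]
      exact P.mul_mem_right _ hg
    set s := 2 * g + (C W.a₁ * X + C W.a₃) with hs
    set u' := mk W Y + ι (g + (C W.a₁ * X + C W.a₃)) with hu'
    refine ⟨Ideal.span {ι p, u'}, ι p, hι0, ?_⟩
    rw [hm, map_mul] at hfac
    rw [hPeq, Ideal.span_pair_mul_span_pair]
    apply le_antisymm
    · rw [Ideal.span_le]
      rintro x (rfl | rfl | rfl | rfl) <;> rw [SetLike.mem_coe, Ideal.mem_span_singleton]
      · exact dvd_mul_right _ _
      · exact dvd_mul_right _ _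
      · exact dvd_mul_left _ _
      · rw [hfac]
        exact (dvd_mul_right _ _).neg_right
    · rw [Ideal.span_singleton_le_iff_mem]
      set T : Ideal W.CoordinateRing := Ideal.span _ with hT
      have m1 : ι p * ι p ∈ T := Ideal.subset_span (by simp)
      have m2 : ι p * u' ∈ T := Ideal.subset_span (by simp)
      have m3 : (mk W Y - ι g) * ι p ∈ T := Ideal.subset_span (by simp)
      have m4 : ι p * ι m ∈ T := by
        rw [← neg_mem_iff, ← hfac]
        exact Ideal.subset_span (by simp)
      have m5 : ι p * ι s ∈ T := by
        have := T.sub_mem m2 m3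
        convert this using 1
        simp only [hs, hu', map_add, map_mul, map_ofNat]
        ring
      -- The product ideal contains `p * p`, `p * s` and `p * m`. By smoothness `p` does not divide
      -- both `s` and `m`, so it contains `p`.
      by_cases hps : p ∣ s
      · have hpm : ¬ p ∣ m := by
          intro hpm
          refine not_dvd_of_sq_dvd_evalY (W := W) (g := g) hpirr ?_ hps
          rw [hm, sq]
          exact mul_dvd_mul_left _ hpm
        obtain ⟨x, y, hxy⟩ : IsCoprime p m := (hpirr.coprime_iff_not_dvd).2 hpm
        have := T.add_mem (T.mul_mem_left (ι x) m1) (T.mul_mem_left (ι y) m4)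
        convert this using 1
        have h2 := congr_arg ι hxy
        simp only [map_add, map_mul, map_one] at h2
        linear_combination -ι p * h2
      · obtain ⟨x, y, hxy⟩ : IsCoprime p s := (hpirr.coprime_iff_not_dvd).2 hps
        have := T.add_mem (T.mul_mem_left (ι x) m1) (T.mul_mem_left (ι y) m5)
        convert this using 1
        have h2 := congr_arg ι hxy
        simp only [map_add, map_mul, map_one] at h2
        linear_combination -ι p * h2

instance [W.IsElliptic] : IsDedekindDomain W.CoordinateRing :=
  isDedekindDomain_of_forall_isMaximal_invertible exists_mul_eq_span_of_isMaximal

end WeierstrassCurve.Affine.CoordinateRing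

/-! ### Codimension of ideals. -/

namespace Ideal

/-- The dimension of `R ⧸ I` over the base field `F`. -/
noncomputable def codim (F : Type*) {R : Type*} [Field F] [CommRing R] [Algebra F R]
    (I : Ideal R) : ℕ :=
  Module.finrank F (R ⧸ I)

end Ideal

/-- Write `I = I * J + (a)`. Multiplication by `a` maps `R` onto `I / (I * J)`, and cancelling `I`
shows that its kernel is `J`. -/
theorem Ideal.nonempty_quotient_equiv_ker_factor {R : Type*} [CommRing R] [IsDedekindDomain R]
    {I J : Ideal R} (hI : I ≠ ⊥) (hJ : J ≠ ⊥) :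
    Nonempty ((R ⧸ J) ≃ₗ[R]
      LinearMap.ker (Submodule.factor (Ideal.mul_le_left : I * J ≤ I))) := by
  obtain ⟨a, ha⟩ := IsDedekindDomain.exists_sup_span_eq (Ideal.mul_le_left (I := I) (J := J))
    (mul_ne_zero hI hJ)
  have haI : a ∈ I := ha ▸ Ideal.mem_sup_right (Ideal.mem_span_singleton_self a)
  let f : R →ₗ[R] R ⧸ I * J := LinearMap.toSpanSingleton R _ (Submodule.Quotient.mk a)
  have hfapp : ∀ r : R, f r = Submodule.Quotient.mk (r * a) := fun r ↦ rfl
  have hker : LinearMap.ker f = J := by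
    ext r
    rw [LinearMap.mem_ker, hfapp, Submodule.Quotient.mk_eq_zero]
    refine ⟨fun h ↦ ?_, fun h ↦ mul_comm a r ▸ Ideal.mul_mem_mul haI h⟩
    have hle : I * Ideal.span {r} ≤ I * J := by
      conv_lhs => rw [← ha]
      rw [Ideal.sup_mul, Ideal.span_singleton_mul_span_singleton, sup_le_iff]
      exact ⟨Ideal.mul_le_left, by
        rw [Ideal.span_singleton_le_iff_mem, mul_comm a r]; exact h⟩
    have hd : I * J ∣ I * Ideal.span {r} := Ideal.dvd_iff_le.2 hle
    rw [mul_dvd_mul_iff_left hI, Ideal.dvd_span_singleton] at hd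
    exact hd
  have hrange : LinearMap.range f =
      LinearMap.ker (Submodule.factor (Ideal.mul_le_left : I * J ≤ I)) := by
    ext x
    obtain ⟨x, rfl⟩ := Submodule.Quotient.mk_surjective _ x
    have hx : Submodule.factor (Ideal.mul_le_left : I * J ≤ I) (Submodule.Quotient.mk x) =
      Submodule.Quotient.mk x := rfl
    rw [LinearMap.mem_ker, hx, Submodule.Quotient.mk_eq_zero, LinearMap.mem_range]
    simp only [hfapp, Submodule.Quotient.eq]
    constructor
    · rintro ⟨r, hr⟩
      rw [← sub_sub_cancel (r * a) x]
      exact I.sub_mem (I.mul_mem_left _ haI) (Ideal.mul_le_left hr)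
    · intro hx
      rw [← ha, Submodule.mem_sup] at hx
      obtain ⟨y, hy, z, hz, rfl⟩ := hx
      obtain ⟨r, rfl⟩ := Ideal.mem_span_singleton'.1 hz
      exact ⟨r, by simpa using hy⟩
  exact ⟨(Submodule.quotEquivOfEq _ _ hker.symm).trans
    (f.quotKerEquivRange.trans (LinearEquiv.ofEq _ _ hrange))⟩

/-- An algebra over a field all of whose nonzero ideals have finite codimension. -/
class FiniteCodim (F R : Type*) [Field F] [CommRing R] [Algebra F R] : Prop where
  finite_quotient : ∀ I : Ideal R, I ≠ ⊥ → Module.Finite F (R ⧸ I)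

namespace Ideal

open UniqueFactorizationMonoid

variable (F : Type*) {R : Type*} [Field F] [CommRing R] [Algebra F R]

lemma codim_top : codim F (⊤ : Ideal R) = 0 := by
  have : Subsingleton (R ⧸ (⊤ : Ideal R)) := Ideal.Quotient.subsingleton_iff.2 rfl
  exact Module.finrank_zero_of_subsingleton

variable [FiniteCodim F R]

variable {F} in
lemma codim_eq_zero_iff {I : Ideal R} (hI : I ≠ ⊥) : codim F I = 0 ↔ I = ⊤ := by
  have := FiniteCodim.finite_quotient (F := F) I hI
  refine ⟨fun h ↦ ?_, fun h ↦ h ▸ codim_top F⟩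
  rw [codim, Module.finrank_zero_iff] at h
  exact Ideal.Quotient.subsingleton_iff.1 h

variable [IsDedekindDomain R]

lemma codim_mul {I J : Ideal R} (hI : I ≠ ⊥) (hJ : J ≠ ⊥) :
    codim F (I * J) = codim F I + codim F J := by
  have hfin := FiniteCodim.finite_quotient (F := F) _ (mul_ne_zero hI hJ)
  obtain ⟨e⟩ := nonempty_quotient_equiv_ker_factor hI hJ
  let g : (R ⧸ I * J) →ₗ[R] R ⧸ I := Submodule.factor Ideal.mul_le_left
  have hsurj : LinearMap.range (g.restrictScalars F) = ⊤ :=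
    LinearMap.range_eq_top.2 fun y ↦ by
      obtain ⟨x, rfl⟩ := Submodule.Quotient.mk_surjective _ y
      exact ⟨Submodule.Quotient.mk x, rfl⟩
  have h1 := LinearMap.finrank_range_add_finrank_ker (g.restrictScalars F)
  have h2 : Module.finrank F (R ⧸ J) = Module.finrank F (LinearMap.ker (g.restrictScalars F)) :=
    (e.restrictScalars F).finrank_eq
  rw [hsurj, finrank_top, ← h2] at h1
  exact h1.symm

variable {F}

lemma codim_le_of_le {I J : Ideal R} (hI : I ≠ ⊥) (h : I ≤ J) : codim F J ≤ codim F I := by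
  obtain ⟨K, rfl⟩ := Ideal.dvd_iff_le.2 h
  rw [codim_mul F (left_ne_zero_of_mul hI) (right_ne_zero_of_mul hI)]
  exact Nat.le_add_right _ _

lemma eq_of_le_of_codim_le {I J : Ideal R} (hI : I ≠ ⊥) (h : I ≤ J)
    (hc : codim F I ≤ codim F J) : I = J := by
  obtain ⟨K, rfl⟩ := Ideal.dvd_iff_le.2 h
  rw [codim_mul F (left_ne_zero_of_mul hI) (right_ne_zero_of_mul hI)] at hc
  rw [(codim_eq_zero_iff (F := F) (right_ne_zero_of_mul hI)).1 (by lia), Ideal.mul_top]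

lemma codim_pow {P : Ideal R} (hP : P ≠ ⊥) (m : ℕ) : codim F (P ^ m) = m * codim F P := by
  induction m with
  | zero => rw [pow_zero, Ideal.one_eq_top, codim_top, zero_mul]
  | succ m ih => rw [pow_succ, codim_mul F (pow_ne_zero m hP) hP, ih, add_mul, one_mul]

lemma codim_multiset_prod (s : Multiset (Ideal R)) (hs : ∀ I ∈ s, I ≠ ⊥) :
    codim F s.prod = (s.map (codim F)).sum := by
  induction s using Multiset.induction with
  | empty => simp [codim_top, Ideal.one_eq_top]
  | cons I s ih =>
    have hs' : ∀ J ∈ s, J ≠ ⊥ := fun J hJ ↦ hs J (Multiset.mem_cons_of_mem hJ)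
    rw [Multiset.prod_cons, codim_mul F (hs I (Multiset.mem_cons_self I s))
      (Multiset.prod_ne_zero fun h ↦ hs' _ h rfl), ih hs', Multiset.map_cons, Multiset.sum_cons]

lemma codim_eq_sum_normalizedFactors {I : Ideal R} (hI : I ≠ ⊥) :
    codim F I = ((normalizedFactors I).map (codim F)).sum := by
  conv_lhs => rw [← Ideal.prod_normalizedFactors_eq_self hI]
  exact codim_multiset_prod _ fun J hJ ↦ (prime_of_normalized_factor J hJ).ne_zero

lemma one_le_codim_of_prime {P : Ideal R} (hP : Prime P) : 1 ≤ codim F P := by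
  rw [Nat.one_le_iff_ne_zero, ne_eq, codim_eq_zero_iff hP.ne_zero]
  exact (Ideal.isPrime_of_prime hP).ne_top

lemma pow_dvd_iff_le_count {P I : Ideal R} (hP : Prime P) (hI : I ≠ ⊥) (m : ℕ) [DecidableEq (Ideal R)] :
    P ^ m ∣ I ↔ m ≤ (normalizedFactors I).count P := by
  rw [pow_dvd_iff_le_emultiplicity, emultiplicity_eq_count_normalizedFactors hP.irreducible hI,
    Nat.cast_le, normalize_eq]

variable (F) in
/-- The nonzero ideals of codimension `n`. -/
def ofCodim (R : Type*) [CommRing R] [Algebra F R] (n : ℕ) : Set (Ideal R) :=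
  {I | I ≠ ⊥ ∧ codim F I = n}

lemma ofCodim_zero : ofCodim F R 0 = {⊤} := by
  ext I
  simp only [ofCodim, Set.mem_ofPred_eq, Set.mem_singleton_iff]
  refine ⟨fun h ↦ (codim_eq_zero_iff h.1).1 h.2, ?_⟩
  rintro rfl
  exact ⟨top_ne_bot, codim_top F⟩

end Ideal

namespace Ideal

open UniqueFactorizationMonoid

/-! ### The Euler product as a recursion. -/

section Euler

variable {F R : Type*} [Field F] [CommRing R] [Algebra F R] [FiniteCodim F R] [IsDedekindDomain R]

variable (F R) in
/-- The prime ideals of codimension at most `n`. -/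
def primesOfCodimLE (n : ℕ) : Set (Ideal R) := {P | Prime P ∧ codim F P ≤ n}

omit [FiniteCodim F R] [IsDedekindDomain R] in
lemma finite_primesOfCodimLE (hfin : ∀ n, (ofCodim F R n).Finite) (n : ℕ) :
    (primesOfCodimLE F R n).Finite := by
  refine ((Set.finite_Iic n).biUnion fun m _ ↦ hfin m).subset fun P hP ↦ ?_
  simp only [Set.mem_iUnion]
  exact ⟨codim F P, hP.2, hP.1.ne_zero, rfl⟩

variable (F R) in
/-- The sum of the codimensions of the prime ideals whose codimension divides `j`. -/
noncomputable def primeCodimSum (j : ℕ) : ℕ :=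
  ∑ᶠ P ∈ {P : Ideal R | Prime P ∧ codim F P ∣ j}, codim F P

omit [FiniteCodim F R] [IsDedekindDomain R] in
open Classical in
lemma primeCodimSum_eq_sum (hfin : ∀ n, (ofCodim F R n).Finite) {j n : ℕ} (hj : 1 ≤ j)
    (hjn : j ≤ n) :
    primeCodimSum F R j =
      ∑ P ∈ (finite_primesOfCodimLE hfin n).toFinset, if codim F P ∣ j then codim F P else 0 := by
  rw [primeCodimSum, ← Finset.sum_filter, ← finsum_mem_coe_finset]
  refine finsum_mem_congr (Set.ext fun P ↦ ?_) fun _ _ ↦ rfl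
  simp only [Finset.coe_filter, Set.Finite.mem_toFinset, Set.mem_ofPred_eq, primesOfCodimLE]
  exact ⟨fun h ↦ ⟨⟨h.1, (Nat.le_of_dvd hj h.2).trans hjn⟩, h.2⟩, fun h ↦ ⟨h.1.1, h.2⟩⟩

open Classical in
-- The exponent of `P` in `I` is the number of `m ≥ 1` with `P ^ m ∣ I`. Cutting off at `n` loses
-- nothing because every prime has codimension at least `1`.
lemma codim_eq_sum_primes (hfin : ∀ n, (ofCodim F R n).Finite) {I : Ideal R} (hI : I ≠ ⊥) {n : ℕ}
    (hn : codim F I = n) :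
    n = ∑ P ∈ (finite_primesOfCodimLE hfin n).toFinset, ∑ m ∈ Finset.Icc 1 n,
      if P ^ m ∣ I then codim F P else 0 := by
  have hprime : ∀ P ∈ normalizedFactors I, Prime P := fun P hP ↦ prime_of_normalized_factor P hP
  have hsub : (normalizedFactors I).toFinset ⊆ (finite_primesOfCodimLE hfin n).toFinset := by
    intro P hP
    rw [Multiset.mem_toFinset] at hP
    rw [Set.Finite.mem_toFinset]
    exact ⟨hprime P hP, hn ▸ codim_le_of_le hI (Ideal.dvd_iff_le.1 (dvd_of_mem_normalizedFactors hP))⟩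
  conv_lhs => rw [← hn, codim_eq_sum_normalizedFactors hI, Finset.sum_multiset_map_count]
  rw [Finset.sum_subset hsub]
  · refine Finset.sum_congr rfl fun P hP ↦ ?_
    rw [Set.Finite.mem_toFinset] at hP
    rw [← Finset.sum_filter, Finset.sum_const, smul_eq_mul, smul_eq_mul]
    congr 1
    have hle : (normalizedFactors I).count P ≤ n := by
      have h1 : codim F (P ^ (normalizedFactors I).count P) ≤ n :=
        hn ▸ codim_le_of_le hI (Ideal.dvd_iff_le.1 ((pow_dvd_iff_le_count hP.1 hI _).2 le_rfl))
      rw [codim_pow hP.1.ne_zero] at h1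
      exact (Nat.le_mul_of_pos_right _ (one_le_codim_of_prime hP.1)).trans h1
    have : (Finset.Icc 1 n).filter (fun m ↦ P ^ m ∣ I) =
        Finset.Icc 1 ((normalizedFactors I).count P) := by
      ext m
      rw [Finset.mem_filter, pow_dvd_iff_le_count hP.1 hI, Finset.mem_Icc, Finset.mem_Icc]
      lia
    rw [this, Nat.card_Icc, Nat.add_sub_cancel]
  · intro P _ hP
    rw [Multiset.mem_toFinset] at hP
    rw [Multiset.count_eq_zero_of_notMem hP, zero_smul]

open Classical in
lemma card_filter_pow_dvd (hfin : ∀ n, (ofCodim F R n).Finite) {P : Ideal R} (hP : Prime P)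
    (m n : ℕ) :
    ((hfin n).toFinset.filter (fun I ↦ P ^ m ∣ I)).card =
      if m * codim F P ≤ n then (ofCodim F R (n - m * codim F P)).ncard else 0 := by
  have hPm : P ^ m ≠ ⊥ := pow_ne_zero m hP.ne_zero
  split_ifs with h
  · rw [Set.ncard_eq_toFinset_card _ (hfin _)]
    symm
    refine Finset.card_bij (fun J _ ↦ P ^ m * J) ?_ ?_ ?_
    · intro J hJ
      rw [Set.Finite.mem_toFinset] at hJ
      rw [Finset.mem_filter, Set.Finite.mem_toFinset]
      refine ⟨⟨mul_ne_zero hPm hJ.1, ?_⟩, dvd_mul_right _ _⟩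
      rw [codim_mul F hPm hJ.1, codim_pow hP.ne_zero, hJ.2]
      lia
    · intro J _ J' _ h
      exact mul_left_cancel₀ hPm h
    · intro I hI
      rw [Finset.mem_filter, Set.Finite.mem_toFinset] at hI
      obtain ⟨⟨hI0, hIn⟩, J, rfl⟩ := hI
      have hJ := right_ne_zero_of_mul hI0
      refine ⟨J, ?_, rfl⟩
      rw [Set.Finite.mem_toFinset]
      refine ⟨hJ, ?_⟩
      rw [codim_mul F hPm hJ, codim_pow hP.ne_zero] at hIn
      lia
  · rw [Finset.card_eq_zero, Finset.filter_eq_empty_iff]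
    rintro I hI ⟨J, rfl⟩
    rw [Set.Finite.mem_toFinset] at hI
    have hIn := hI.2
    rw [codim_mul F hPm (right_ne_zero_of_mul hI.1), codim_pow hP.ne_zero] at hIn
    lia

/-- The Euler product of the zeta function of `R`, in the form of a recursion. -/
theorem mul_ncard_ofCodim (hfin : ∀ n, (ofCodim F R n).Finite) (n : ℕ) :
    n * (ofCodim F R n).ncard =
      ∑ j ∈ Finset.Icc 1 n, primeCodimSum F R j * (ofCodim F R (n - j)).ncard := by
  classical
  set Ps := (finite_primesOfCodimLE hfin n).toFinset with hPs
  have h1 : n * (ofCodim F R n).ncard = ∑ I ∈ (hfin n).toFinset, ∑ P ∈ Ps, ∑ m ∈ Finset.Icc 1 n,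
      if P ^ m ∣ I then codim F P else 0 := by
    rw [Set.ncard_eq_toFinset_card _ (hfin n), mul_comm, ← smul_eq_mul, ← Finset.sum_const]
    refine Finset.sum_congr rfl fun I hI ↦ ?_
    rw [Set.Finite.mem_toFinset] at hI
    exact codim_eq_sum_primes hfin hI.1 hI.2
  have h2 : ∀ j ∈ Finset.Icc 1 n, primeCodimSum F R j * (ofCodim F R (n - j)).ncard =
      ∑ P ∈ Ps, if codim F P ∣ j then codim F P * (ofCodim F R (n - j)).ncard else 0 := by
    intro j hj
    rw [Finset.mem_Icc] at hj
    rw [primeCodimSum_eq_sum hfin hj.1 hj.2, Finset.sum_mul]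
    exact Finset.sum_congr rfl fun P _ ↦ by rw [ite_mul, zero_mul]
  rw [h1, Finset.sum_congr rfl h2, Finset.sum_comm, Finset.sum_comm (s := Finset.Icc 1 n)]
  refine Finset.sum_congr rfl fun P hP ↦ ?_
  rw [hPs, Set.Finite.mem_toFinset] at hP
  have hd := one_le_codim_of_prime (F := F) hP.1
  rw [Finset.sum_comm]
  have h3 : ∀ m ∈ Finset.Icc 1 n, (∑ I ∈ (hfin n).toFinset, if P ^ m ∣ I then codim F P else 0) =
      if m * codim F P ≤ n then codim F P * (ofCodim F R (n - m * codim F P)).ncard else 0 := by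
    intro m _
    rw [← Finset.sum_filter, Finset.sum_const, smul_eq_mul, card_filter_pow_dvd hfin hP.1, mul_comm,
      mul_ite, mul_zero]
  rw [Finset.sum_congr rfl h3, ← Finset.sum_filter, ← Finset.sum_filter]
  -- For a fixed `P`, the powers `P ^ m` contribute at the multiples `j = m * codim F P`.
  refine Finset.sum_bij (fun m _ ↦ m * codim F P) ?_ ?_ ?_ ?_
  · intro m hm
    rw [Finset.mem_filter, Finset.mem_Icc] at hm ⊢
    exact ⟨⟨Nat.mul_pos hm.1.1 hd, hm.2⟩, dvd_mul_left _ _⟩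
  · intro a _ b _ h
    exact Nat.eq_of_mul_eq_mul_right hd h
  · intro j hj
    rw [Finset.mem_filter, Finset.mem_Icc] at hj
    obtain ⟨⟨hj1, hjn⟩, m, rfl⟩ := hj
    have hm : 1 ≤ m := Nat.pos_of_mul_pos_left (a := codim F P) (by lia)
    refine ⟨m, ?_, mul_comm _ _⟩
    rw [Finset.mem_filter, Finset.mem_Icc, mul_comm m]
    exact ⟨⟨hm, (Nat.le_mul_of_pos_left m hd).trans hjn⟩, hjn⟩
  · intro m _
    rfl

end Euler

/-! ### Riemann-Roch in genus one and the number of ideals. -/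

section GenusOne

variable {F R : Type*} [Field F] [CommRing R] [Algebra F R]

/-- A filtration of `R` by the subspaces of elements of bounded codimension, whose `m`-th piece has
dimension `m` for `m ≥ 1`. -/
structure GenusOneFiltration (V : ℕ → Submodule F R) : Prop where
  mem_iff : ∀ m f, f ∈ V m ↔ f = 0 ∨ codim F (Ideal.span {f}) ≤ m
  finrank_eq : ∀ m, 1 ≤ m → Module.finrank F (V m) = m

namespace GenusOneFiltration

variable {V : ℕ → Submodule F R}

lemma mono (hV : GenusOneFiltration V) : Monotone V := fun a b hab f hf ↦ by
  rw [hV.mem_iff] at hf ⊢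
  exact hf.imp_right (·.trans hab)

lemma finiteDimensional (hV : GenusOneFiltration V) (m : ℕ) : FiniteDimensional F (V m) := by
  have : FiniteDimensional F (V (m + 1)) :=
    Module.finite_of_finrank_pos (by rw [hV.finrank_eq _ (by lia)]; lia)
  exact Submodule.finiteDimensional_of_le (hV.mono (Nat.le_succ m))

/-- The elements of `I` in the `m`-th piece of the filtration. -/
def _root_.Ideal.infFiltration (V : ℕ → Submodule F R) (I : Ideal R) (m : ℕ) : Submodule F R :=
  V m ⊓ I.restrictScalars F

lemma mem_infFiltration {I : Ideal R} {m : ℕ} {f : R} :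
    f ∈ I.infFiltration V m ↔ f ∈ V m ∧ f ∈ I := Iff.rfl

variable [FiniteCodim F R]

/-- Riemann's inequality: rank-nullity for the map from `V m` to `R ⧸ I`. -/
lemma le_finrank_add_codim (hV : GenusOneFiltration V) {I : Ideal R} (hI : I ≠ ⊥) {m : ℕ}
    (hm : 1 ≤ m) : m ≤ Module.finrank F (I.infFiltration V m) + codim F I := by
  have := FiniteCodim.finite_quotient (F := F) I hI
  have := hV.finiteDimensional m
  let g : V m →ₗ[F] R ⧸ I := (Ideal.Quotient.mkₐ F I).toLinearMap ∘ₗ (V m).subtype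
  have h1 := LinearMap.finrank_range_add_finrank_ker g
  have h2 : LinearMap.ker g = (I.restrictScalars F).comap (V m).subtype := by
    ext x
    exact Ideal.Quotient.eq_zero_iff_mem
  have h3 : Module.finrank F (LinearMap.ker g) = Module.finrank F (I.infFiltration V m) := by
    rw [h2, ← Submodule.finrank_map_subtype_eq, Submodule.map_comap_subtype, infFiltration]
  have h4 : Module.finrank F (LinearMap.range g) ≤ codim F I := Submodule.finrank_le _
  rw [hV.finrank_eq m hm] at h1
  lia

omit [FiniteCodim F R] in
-- The quotient of the pieces of `I` at levels `b` and `a` embeds in `V b / V a`, of dimension `b -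
-- a`.
lemma finrank_infFiltration_add_le (hV : GenusOneFiltration V) (I : Ideal R) {a b : ℕ}
    (ha : 1 ≤ a) (hab : a ≤ b) :
    Module.finrank F (I.infFiltration V b) + a ≤ Module.finrank F (I.infFiltration V a) + b := by
  have := hV.finiteDimensional a
  have := hV.finiteDimensional b
  have : FiniteDimensional F (I.infFiltration V b) :=
    Submodule.finiteDimensional_of_le (inf_le_left : I.infFiltration V b ≤ V b)
  have h1 := Submodule.finrank_sup_add_finrank_inf_eq (I.infFiltration V b) (V a)
  have h2 : I.infFiltration V b ⊓ V a = I.infFiltration V a := by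
    rw [infFiltration, infFiltration, inf_right_comm, inf_eq_right.2 (hV.mono hab)]
  have h3 : Module.finrank F (I.infFiltration V b ⊔ V a : Submodule F R) ≤ Module.finrank F (V b) :=
    Submodule.finrank_mono (sup_le inf_le_left (hV.mono hab))
  rw [hV.finrank_eq b (ha.trans hab)] at h3
  rw [hV.finrank_eq a ha, h2] at h1
  lia

variable [IsDedekindDomain R]

/-- If `I` has a nonzero element `f` of codimension at most that of `I`, then `I = (f)`, and
division by `f` lands in the one-dimensional `V 1`. Otherwise the piece one level lower is zero, and
a single step adds at most one dimension. -/
lemma finrank_infFiltration_succ_le (hV : GenusOneFiltration V) {I : Ideal R} (hI : I ≠ ⊥) :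
    Module.finrank F (I.infFiltration V (codim F I + 1)) ≤ 1 := by
  by_cases h : ∃ f ∈ I.infFiltration V (codim F I), f ≠ 0
  · obtain ⟨f, ⟨hfV, hfI⟩, hf0⟩ := h
    have hspan : Ideal.span {f} ≠ (⊥ : Ideal R) := by simpa using hf0
    have hIeq : Ideal.span {f} = I := by
      refine eq_of_le_of_codim_le (F := F) hspan (by rwa [Ideal.span_singleton_le_iff_mem]) ?_
      exact ((hV.mem_iff _ _).1 hfV).resolve_left hf0
    have := hV.finiteDimensional 1
    refine le_trans (Submodule.finrank_mono ?_)
      ((Submodule.finrank_map_le (LinearMap.mulLeft F f) (V 1)).trans_eq (hV.finrank_eq 1 le_rfl))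
    intro g hg
    obtain ⟨hgV, hgI⟩ := mem_infFiltration.1 hg
    rw [← hIeq, Ideal.mem_span_singleton] at hgI
    obtain ⟨x, rfl⟩ := hgI
    refine ⟨x, (hV.mem_iff _ _).2 (or_iff_not_imp_left.2 fun hx ↦ ?_), rfl⟩
    have hx' : Ideal.span {x} ≠ (⊥ : Ideal R) := by simpa using hx
    have h1 := ((hV.mem_iff _ _).1 hgV).resolve_left (mul_ne_zero hf0 hx)
    rw [← Ideal.span_singleton_mul_span_singleton, codim_mul F hspan hx', hIeq] at h1
    lia
  · push Not at h
    have hbot : I.infFiltration V (codim F I) = ⊥ := (Submodule.eq_bot_iff _).2 h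
    have hpos : 1 ≤ codim F I := by
      rw [Nat.one_le_iff_ne_zero]
      intro h0
      have htop := (codim_eq_zero_iff (F := F) hI).1 h0
      refine one_ne_zero (h 1 ⟨(hV.mem_iff _ _).2 (Or.inr ?_), ?_⟩)
      · rw [Ideal.span_singleton_one, codim_top]
        exact Nat.zero_le _
      · rw [htop]; trivial
    have := hV.finrank_infFiltration_add_le I hpos (Nat.le_succ _)
    rw [hbot, finrank_bot] at this
    lia

/-- The Riemann-Roch theorem in genus one. -/
theorem finrank_infFiltration (hV : GenusOneFiltration V) {I : Ideal R} (hI : I ≠ ⊥) {m : ℕ}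
    (hm : codim F I < m) : Module.finrank F (I.infFiltration V m) = m - codim F I := by
  have h1 := hV.le_finrank_add_codim hI (show 1 ≤ m by lia)
  have h2 := hV.finrank_infFiltration_add_le I (a := codim F I + 1) (by lia) hm
  have h3 := hV.finrank_infFiltration_succ_le hI
  lia

lemma ncard_infFiltration (hV : GenusOneFiltration V) {I : Ideal R} (hI : I ≠ ⊥) {m : ℕ}
    (hm : codim F I < m) :
    (I.infFiltration V m : Set R).ncard = Nat.card F ^ (m - codim F I) := by
  have := hV.finiteDimensional m
  have : FiniteDimensional F (I.infFiltration V m) :=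
    Submodule.finiteDimensional_of_le (inf_le_left : I.infFiltration V m ≤ V m)
  rw [← Nat.card_coe_set_eq, ← hV.finrank_infFiltration hI hm]
  exact Module.natCard_eq_pow_finrank (K := F) (V := I.infFiltration V m)

variable [Finite F]

omit [IsDedekindDomain R] [FiniteCodim F R] in
lemma finite (hV : GenusOneFiltration V) (m : ℕ) : (V m : Set R).Finite := by
  have := hV.finiteDimensional m
  have : Finite (V m) := Module.finite_of_finite F
  exact Set.toFinite _

omit [IsDedekindDomain R] [FiniteCodim F R] in
lemma finite_infFiltration (hV : GenusOneFiltration V) (I : Ideal R) (m : ℕ) :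
    (I.infFiltration V m : Set R).Finite :=
  (hV.finite m).subset fun _ h ↦ h.1

omit [Finite F] in
lemma ncard_mem_le (hV : GenusOneFiltration V) {I : Ideal R} (hI : I ≠ ⊥) :
    {f : R | f ≠ 0 ∧ f ∈ I ∧ codim F (Ideal.span {f}) ≤ codim F I + 1}.ncard = Nat.card F - 1 := by
  have h : {f : R | f ≠ 0 ∧ f ∈ I ∧ codim F (Ideal.span {f}) ≤ codim F I + 1} =
      (I.infFiltration V (codim F I + 1) : Set R) \ {0} := by
    ext f
    simp only [Set.mem_ofPred_eq, Set.mem_sdiff, SetLike.mem_coe, mem_infFiltration, hV.mem_iff,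
      Set.mem_singleton_iff]
    tauto
  rw [h, Set.ncard_sdiff_singleton_of_mem (Submodule.zero_mem _),
    hV.ncard_infFiltration hI (Nat.lt_add_one _), Nat.add_sub_cancel_left, pow_one]

/-- For `n ≥ 2` both levels `n` and `n - 1` above `codim F I` lie in the range of Riemann-Roch. -/
lemma ncard_mem_eq (hV : GenusOneFiltration V) {I : Ideal R} (hI : I ≠ ⊥) {n : ℕ} (hn : 2 ≤ n) :
    {f : R | f ≠ 0 ∧ f ∈ I ∧ codim F (Ideal.span {f}) = n + codim F I}.ncard =
      Nat.card F ^ n - Nat.card F ^ (n - 1) := by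
  have h : {f : R | f ≠ 0 ∧ f ∈ I ∧ codim F (Ideal.span {f}) = n + codim F I} =
      (I.infFiltration V (n + codim F I) : Set R) \ I.infFiltration V (n - 1 + codim F I) := by
    ext f
    simp only [Set.mem_ofPred_eq, Set.mem_sdiff, SetLike.mem_coe, mem_infFiltration, hV.mem_iff]
    have : codim F (Ideal.span {f}) = n + codim F I ↔ codim F (Ideal.span {f}) ≤ n + codim F I ∧
      ¬ codim F (Ideal.span {f}) ≤ n - 1 + codim F I := by lia
    rw [this]
    tauto
  have hsub : (I.infFiltration V (n - 1 + codim F I) : Set R) ⊆ I.infFiltration V (n + codim F I) :=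
    fun f hf ↦ ⟨hV.mono (by lia) hf.1, hf.2⟩
  rw [h, Set.ncard_sdiff hsub (hV.finite_infFiltration _ _), hV.ncard_infFiltration hI (by lia),
    hV.ncard_infFiltration hI (by lia), Nat.add_sub_cancel, Nat.add_sub_cancel]

omit [IsDedekindDomain R] in
-- By Riemann's inequality each such ideal contains a nonzero element of the finite set `V (n + 1)`,
-- and only finitely many ideals contain a given nonzero element.
lemma finite_ofCodim (hV : GenusOneFiltration V) (n : ℕ) : (ofCodim F R n).Finite := by
  refine ((hV.finite (n + 1)).sdiff (t := {0}) |>.biUnion (t := fun f ↦ {I | Ideal.span {f} ≤ I})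
    fun f hf ↦ ?_).subset ?_
  · have hspan : Ideal.span {f} ≠ (⊥ : Ideal R) := by simpa using hf.2
    have := FiniteCodim.finite_quotient (F := F) _ hspan
    have := Module.finite_of_finite F (M := R ⧸ Ideal.span {f})
    have hfin : Finite (Ideal (R ⧸ Ideal.span {f})) := Finite.of_injective _ SetLike.coe_injective
    refine (Set.finite_range fun J : Ideal (R ⧸ Ideal.span {f}) ↦
      J.comap (Ideal.Quotient.mk _)).subset fun I hI ↦ ⟨I.map (Ideal.Quotient.mk _), ?_⟩
    simp only [Ideal.comap_map_mk hI]
  · rintro I ⟨hI0, rfl⟩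
    have h := hV.le_finrank_add_codim hI0 (m := codim F I + 1) (by lia)
    have hne : I.infFiltration V (codim F I + 1) ≠ ⊥ := by
      intro hb
      rw [hb, finrank_bot] at h
      lia
    obtain ⟨f, hf, hf0⟩ := Submodule.exists_mem_ne_zero_of_ne_bot hne
    simp only [Set.mem_iUnion]
    exact ⟨f, ⟨hf.1, hf0⟩, (Ideal.span_singleton_le_iff_mem _).2 hf.2⟩

omit [FiniteCodim F R] [IsDedekindDomain R] in
lemma finite_span_eq (hV : GenusOneFiltration V) (I : Ideal R) :
    {f : R | Ideal.span {f} = I}.Finite := by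
  refine (hV.finite (codim F I)).subset ?_
  rintro f rfl
  exact (hV.mem_iff _ _).2 (Or.inr le_rfl)

omit [FiniteCodim F R] in
lemma sum_ncard_span_eq (hV : GenusOneFiltration V) {I : Ideal R} (hI : I ≠ ⊥)
    (S : Finset (Ideal R)) :
    ∑ J ∈ S, {f : R | Ideal.span {f} = I * J}.ncard =
      {f : R | ∃ J ∈ S, Ideal.span {f} = I * J}.ncard := by
  classical
  have h : {f : R | ∃ J ∈ S, Ideal.span {f} = I * J} =
      S.biUnion fun J ↦ (hV.finite_span_eq (I * J)).toFinset := by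
    ext f
    simp
  rw [h, Set.ncard_coe_finset, Finset.card_biUnion]
  · exact Finset.sum_congr rfl fun J _ ↦ Set.ncard_eq_toFinset_card _ _
  · intro J _ J' _ hne
    rw [Function.onFun, Finset.disjoint_left]
    intro f hf hf'
    rw [Set.Finite.mem_toFinset] at hf hf'
    exact hne (mul_left_cancel₀ hI (hf.symm.trans hf'))

/-- Count triples `(I, J, f)` with `(f) = I * J`, `codim I = n` and `codim J ≤ 1` in two ways. Each
`I` admits `q - 1` elements `f`, each `J` admits `q ^ n - q ^ (n - 1)`, and `f` determines the
remaining ideal. -/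
theorem sub_one_mul_ncard_ofCodim (hV : GenusOneFiltration V) {n : ℕ} (hn : 2 ≤ n) :
    (ofCodim F R n).ncard * (Nat.card F - 1) =
      (1 + (ofCodim F R 1).ncard) * (Nat.card F ^ n - Nat.card F ^ (n - 1)) := by
  classical
  set S := (hV.finite_ofCodim 0).toFinset ∪ (hV.finite_ofCodim 1).toFinset with hS
  have hmemS : ∀ J : Ideal R, J ∈ S ↔ J ≠ ⊥ ∧ codim F J ≤ 1 := by
    intro J
    rw [hS, Finset.mem_union, Set.Finite.mem_toFinset, Set.Finite.mem_toFinset]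
    simp only [ofCodim, Set.mem_ofPred_eq]
    rw [← and_or_left]
    refine and_congr_right fun _ ↦ ?_
    lia
  have hScard : S.card = 1 + (ofCodim F R 1).ncard := by
    rw [hS, Finset.card_union_of_disjoint, ← Set.ncard_eq_toFinset_card _ (hV.finite_ofCodim 0),
      ofCodim_zero, Set.ncard_singleton, ← Set.ncard_eq_toFinset_card _ (hV.finite_ofCodim 1)]
    rw [Finset.disjoint_left]
    intro J h0 h1
    rw [Set.Finite.mem_toFinset] at h0 h1
    exact zero_ne_one (h0.2.symm.trans h1.2)
  rw [← hScard, Set.ncard_eq_toFinset_card _ (hV.finite_ofCodim n), ← smul_eq_mul, ← smul_eq_mul,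
    ← Finset.sum_const, ← Finset.sum_const]
  have h1 : ∀ I ∈ (hV.finite_ofCodim n).toFinset,
      Nat.card F - 1 = ∑ J ∈ S, {f : R | Ideal.span {f} = I * J}.ncard := by
    intro I hI
    rw [Set.Finite.mem_toFinset] at hI
    rw [hV.sum_ncard_span_eq hI.1, ← hV.ncard_mem_le hI.1]
    congr 1
    ext f
    simp only [Set.mem_ofPred_eq]
    constructor
    · rintro ⟨hf0, hfI, hf⟩
      obtain ⟨J, hJ⟩ := Ideal.dvd_span_singleton.2 hfI
      have hspan : Ideal.span {f} ≠ (⊥ : Ideal R) := by simpa using hf0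
      rw [hJ] at hspan
      have hJ0 := right_ne_zero_of_mul hspan
      refine ⟨J, (hmemS J).2 ⟨hJ0, ?_⟩, hJ⟩
      rw [hJ, codim_mul F hI.1 hJ0] at hf
      lia
    · rintro ⟨J, hJS, hJ⟩
      obtain ⟨hJ0, hJ1⟩ := (hmemS J).1 hJS
      have hspan : Ideal.span {f} ≠ (⊥ : Ideal R) := hJ ▸ mul_ne_zero hI.1 hJ0
      refine ⟨by simpa using hspan, Ideal.dvd_span_singleton.1 ⟨J, hJ⟩, ?_⟩
      rw [hJ, codim_mul F hI.1 hJ0]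
      lia
  have h2 : ∀ J ∈ S, Nat.card F ^ n - Nat.card F ^ (n - 1) =
      ∑ I ∈ (hV.finite_ofCodim n).toFinset, {f : R | Ideal.span {f} = J * I}.ncard := by
    intro J hJ
    obtain ⟨hJ0, hJ1⟩ := (hmemS J).1 hJ
    rw [hV.sum_ncard_span_eq hJ0, ← hV.ncard_mem_eq hJ0 hn]
    congr 1
    ext f
    simp only [Set.mem_ofPred_eq, Set.Finite.mem_toFinset]
    constructor
    · rintro ⟨hf0, hfJ, hf⟩
      obtain ⟨I, hI⟩ := Ideal.dvd_span_singleton.2 hfJ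
      have hspan : Ideal.span {f} ≠ (⊥ : Ideal R) := by simpa using hf0
      rw [hI] at hspan
      have hI0 := right_ne_zero_of_mul hspan
      refine ⟨I, ⟨hI0, ?_⟩, hI⟩
      rw [hI, codim_mul F hJ0 hI0] at hf
      lia
    · rintro ⟨I, ⟨hI0, hIn⟩, hI⟩
      have hspan : Ideal.span {f} ≠ (⊥ : Ideal R) := hI ▸ mul_ne_zero hJ0 hI0
      refine ⟨by simpa using hspan, Ideal.dvd_span_singleton.1 ⟨I, hI⟩, ?_⟩
      rw [hI, codim_mul F hJ0 hI0, hIn, add_comm]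
  rw [Finset.sum_congr rfl h1, Finset.sum_congr rfl h2, Finset.sum_comm]
  simp only [mul_comm]

theorem ncard_ofCodim (hV : GenusOneFiltration V) {n : ℕ} (hn : 2 ≤ n) :
    (ofCodim F R n).ncard = (1 + (ofCodim F R 1).ncard) * Nat.card F ^ (n - 1) := by
  have hq : 1 < Nat.card F := Finite.one_lt_card
  have h := hV.sub_one_mul_ncard_ofCodim hn
  obtain ⟨n, rfl⟩ : ∃ m, n = m + 1 := ⟨n - 1, by lia⟩
  rw [Nat.add_sub_cancel, pow_succ', ← Nat.sub_one_mul, ← mul_assoc, mul_right_comm] at h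
  exact Nat.eq_of_mul_eq_mul_right (by lia) h

end GenusOneFiltration

end GenusOne

end Ideal

/-! ### Homomorphisms to finite fields and prime ideals. -/

namespace Ideal

variable {F R : Type*} [Field F] [CommRing R] [Algebra F R] [IsDedekindDomain R]

/-- Homomorphisms with kernel the maximal ideal `P` are homomorphisms on the residue field. -/
noncomputable def algHomKerEquiv (K : Type*) [Field K] [Algebra F K] (P : Ideal R) [hP : P.IsMaximal] :
    {φ : R →ₐ[F] K // RingHom.ker φ = P} ≃ ((R ⧸ P) →ₐ[F] K) where
  toFun φ := Ideal.Quotient.liftₐ P φ.1 fun a ha ↦ by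
    rw [← RingHom.mem_ker, φ.2]; exact ha
  invFun ψ := ⟨ψ.comp (Ideal.Quotient.mkₐ F P), by
    refine (hP.eq_of_le (RingHom.ker_ne_top _) fun a ha ↦ ?_).symm
    rw [RingHom.mem_ker, AlgHom.comp_apply, Ideal.Quotient.mkₐ_eq_mk,
      Ideal.Quotient.eq_zero_iff_mem.2 ha, map_zero]⟩
  left_inv φ := by
    apply Subtype.ext
    ext a
    rfl
  right_inv ψ := by
    refine DFunLike.ext _ _ fun a ↦ ?_
    obtain ⟨a, rfl⟩ := Ideal.Quotient.mk_surjective a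
    rfl

lemma card_algHom_ker_eq {K : Type*} [Field K] [Finite K] [Algebra F K] {P : Ideal R}
    (hP : Prime P) :
    Nat.card {φ : R →ₐ[F] K // RingHom.ker φ = P} =
      if codim F P ∣ Module.finrank F K then codim F P else 0 := by
  have : P.IsMaximal := (Ideal.isPrime_of_prime hP).isMaximal hP.ne_zero
  rw [Nat.card_congr (algHomKerEquiv K P)]
  let := Ideal.Quotient.field P
  split_ifs with h
  · exact FiniteField.natCard_algHom_of_finrank_dvd h
  · have : IsEmpty ((R ⧸ P) →ₐ[F] K) := not_nonempty_iff.1 fun hne ↦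
      h (FiniteField.nonempty_algHom_iff_finrank_dvd.1 hne)
    exact Nat.card_of_isEmpty

/-- Group the homomorphisms by kernel. Since `R` is infinite and `K` finite, kernels are nonzero
primes; a residue field of degree `d` has `d` embeddings into `K` if `d` divides the degree of `K`,
and none otherwise. -/
theorem card_algHom [FiniteCodim F R] [Infinite R] (hfin : ∀ n, (ofCodim F R n).Finite)
    (K : Type*) [Field K] [Finite K] [Algebra F K] [Finite (R →ₐ[F] K)] :
    Nat.card (R →ₐ[F] K) = primeCodimSum F R (Module.finrank F K) := by
  classical
  have := Finite.of_injective _ (algebraMap F K).injective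
  have hpos : 1 ≤ Module.finrank F K := Module.finrank_pos
  have := Fintype.ofFinite (R →ₐ[F] K)
  rw [primeCodimSum_eq_sum hfin hpos le_rfl, Nat.card_eq_fintype_card, ← Finset.card_univ]
  have hker : ∀ φ : R →ₐ[F] K, Prime (RingHom.ker φ) := fun φ ↦ by
    refine Ideal.prime_of_isPrime (fun h ↦ ?_) (RingHom.ker_isPrime φ)
    exact not_finite_iff_infinite.2 ‹Infinite R›
      (Finite.of_injective φ ((RingHom.injective_iff_ker_eq_bot φ).2 h))
  have hcard : ∀ P : Ideal R, (Finset.univ.filter fun φ : R →ₐ[F] K ↦ RingHom.ker φ = P).card =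
      Nat.card {φ : R →ₐ[F] K // RingHom.ker φ = P} := fun P ↦ by
    rw [Nat.card_eq_fintype_card, Fintype.card_subtype]
  rw [Finset.card_eq_sum_card_fiberwise (f := fun φ : R →ₐ[F] K ↦ RingHom.ker φ)
    (t := (finite_primesOfCodimLE hfin (Module.finrank F K)).toFinset)]
  · refine Finset.sum_congr rfl fun P hP ↦ ?_
    rw [Set.Finite.mem_toFinset] at hP
    rw [hcard, card_algHom_ker_eq hP.1]
  · intro φ _
    rw [SetLike.mem_coe, Set.Finite.mem_toFinset]
    refine ⟨hker φ, Nat.le_of_dvd hpos ?_⟩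
    by_contra hdvd
    have h0 := card_algHom_ker_eq (F := F) (K := K) (hker φ)
    rw [if_neg hdvd, Nat.card_eq_zero] at h0
    rcases h0 with h0 | h0
    · exact h0.elim ⟨φ, rfl⟩
    · exact h0.not_finite inferInstance

end Ideal

/-! ### Pole orders and points of the curve. -/

namespace WeierstrassCurve.Affine.CoordinateRing

open Polynomial Ideal
open scoped Polynomial.Bivariate

variable {F : Type*} [Field F] (W : Affine F)

instance : FiniteCodim F W.CoordinateRing where
  finite_quotient _ hI :=
    Module.Finite.equiv (Ideal.quotientEquivDirectSum F (CoordinateRing.basis W) hI).symm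

/-- Elements `p + q * y` of the coordinate ring with bounds on the degrees of `p` and `q`. -/
noncomputable def ofDegreeLT (a b : ℕ) :
    (degreeLT F a × degreeLT F b) →ₗ[F] W.CoordinateRing :=
  (((LinearMap.toSpanSingleton F[X] W.CoordinateRing 1).restrictScalars F).comp
      (degreeLT F a).subtype).coprod
    (((LinearMap.toSpanSingleton F[X] W.CoordinateRing (mk W Y)).restrictScalars F).comp
      (degreeLT F b).subtype)

lemma ofDegreeLT_apply (a b : ℕ) (x : degreeLT F a × degreeLT F b) :
    ofDegreeLT W a b x = (x.1 : F[X]) • (1 : W.CoordinateRing) + (x.2 : F[X]) • mk W Y :=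
  rfl

/-- The elements whose pole at infinity has order at most `m`. -/
noncomputable def poleFiltration (m : ℕ) : Submodule F W.CoordinateRing :=
  LinearMap.range (ofDegreeLT W (m / 2 + 1) ((m - 1) / 2))

lemma smul_add_smul_mem_poleFiltration {m : ℕ} (p q : F[X]) :
    p • (1 : W.CoordinateRing) + q • mk W Y ∈ poleFiltration W m ↔
      p.degree < (m / 2 + 1 : ℕ) ∧ q.degree < ((m - 1) / 2 : ℕ) := by
  constructor
  · rintro ⟨⟨⟨p', hp'⟩, ⟨q', hq'⟩⟩, h⟩
    rw [ofDegreeLT_apply, ← sub_eq_zero, add_sub_add_comm, ← sub_smul, ← sub_smul] at h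
    obtain ⟨h1, h2⟩ := smul_basis_eq_zero h
    rw [← sub_eq_zero.1 h1, ← sub_eq_zero.1 h2]
    exact ⟨mem_degreeLT.1 hp', mem_degreeLT.1 hq'⟩
  · rintro ⟨hp, hq⟩
    exact ⟨⟨⟨p, mem_degreeLT.2 hp⟩, ⟨q, mem_degreeLT.2 hq⟩⟩, rfl⟩

lemma eq_zero_or_codim_le_iff (f : W.CoordinateRing) (m : ℕ) :
    f = 0 ∨ codim F (Ideal.span {f}) ≤ m ↔ (Algebra.norm F[X] f).degree ≤ m := by
  by_cases hf : f = 0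
  · simp [hf, Algebra.norm_zero]
  · rw [codim, finrank_quotient_span_eq_natDegree_norm (CoordinateRing.basis W) hf,
      natDegree_le_iff_degree_le]
    simp [hf]

/-- The codimension of `(f)` is the degree of the norm of `f`, which for `p + q y` is `max (2 deg p)
(2 deg q + 3)`: `x` has a pole of order 2 and `y` one of order 3. The dimensions `m / 2 + 1` and `(m
- 1) / 2` add up to `m` once `m ≥ 1`. -/
lemma genusOneFiltration : GenusOneFiltration (poleFiltration W) where
  mem_iff m f := by
    rw [eq_zero_or_codim_le_iff]
    obtain ⟨p, q, rfl⟩ := exists_smul_basis_eq f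
    rw [smul_add_smul_mem_poleFiltration, degree_norm_smul_basis, max_le_iff]
    have h1 : p.degree < (m / 2 + 1 : ℕ) ↔ 2 • p.degree ≤ m := by
      rcases p.degree with _ | d
      · exact iff_of_true (WithBot.bot_lt_coe _) bot_le
      · change ((d : ℕ) : WithBot ℕ) < _ ↔ 2 • ((d : ℕ) : WithBot ℕ) ≤ _
        rw [two_nsmul]
        norm_cast
        lia
    have h2 : q.degree < ((m - 1) / 2 : ℕ) ↔ 2 • q.degree + 3 ≤ m := by
      rcases q.degree with _ | d
      · exact iff_of_true (WithBot.bot_lt_coe _) bot_le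
      · change ((d : ℕ) : WithBot ℕ) < _ ↔ 2 • ((d : ℕ) : WithBot ℕ) + 3 ≤ _
        rw [two_nsmul]
        norm_cast
        lia
    rw [h1, h2]
  finrank_eq m hm := by
    have hinj : Function.Injective (ofDegreeLT W (m / 2 + 1) ((m - 1) / 2)) := by
      rw [injective_iff_map_eq_zero]
      rintro ⟨p, q⟩ h
      obtain ⟨h1, h2⟩ := smul_basis_eq_zero h
      exact Prod.ext (Subtype.ext h1) (Subtype.ext h2)
    have hd : ∀ n, Module.finrank F (degreeLT F n) = n := fun n ↦ by
      rw [(degreeLTEquiv F n).finrank_eq, Module.finrank_fin_fun]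
    have (n : ℕ) : Module.Finite F (degreeLT F n) :=
      Module.Finite.equiv (degreeLTEquiv F n).symm
    rw [poleFiltration, LinearMap.finrank_range_of_inj hinj, Module.finrank_prod, hd, hd]
    lia

instance : Infinite W.CoordinateRing :=
  Infinite.of_injective _ (FaithfulSMul.algebraMap_injective F[X] W.CoordinateRing)

section Points

variable {W} {K : Type*} [Field K] [Algebra F K]

lemma algHom_ext {φ ψ : W.CoordinateRing →ₐ[F] K} (hX : φ (mk W (C X)) = ψ (mk W (C X)))
    (hY : φ (mk W Y) = ψ (mk W Y)) : φ = ψ := by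
  have hC : ∀ p : F[X], φ (mk W (C p)) = ψ (mk W (C p)) := fun p ↦ by
    let ι : F[X] →ₐ[F] W.CoordinateRing := IsScalarTower.toAlgHom F F[X] W.CoordinateRing
    have : φ.comp ι = ψ.comp ι := Polynomial.algHom_ext hX
    exact DFunLike.congr_fun this p
  refine DFunLike.ext _ _ fun f ↦ ?_
  obtain ⟨p, q, rfl⟩ := exists_smul_basis_eq f
  simp only [smul, map_add, map_mul, map_one, hC, hY]

lemma equation_algHom (φ : W.CoordinateRing →ₐ[F] K) :
    (W.map (algebraMap F K)).Equation (φ (mk W (C X))) (φ (mk W Y)) := by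
  have h : mk W (Y ^ 2 + C (C W.a₁ * X + C W.a₃) * Y -
      C (X ^ 3 + C W.a₂ * X ^ 2 + C W.a₄ * X + C W.a₆)) = 0 :=
    AdjoinRoot.mk_eq_zero.2 (dvd_of_eq rfl)
  have hc : ∀ a : F, φ (mk W (C (C a))) = algebraMap F K a := fun a ↦ φ.commutes a
  have h2 := congr_arg φ h
  simp only [map_add, map_sub, map_mul, map_pow, map_zero, hc] at h2
  rw [equation_iff', ← h2]
  simp only [map_a₁, map_a₂, map_a₃, map_a₄, map_a₆]
  ring

lemma exists_algHom {x y : K} (h : (W.map (algebraMap F K)).Equation x y) :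
    ∃ φ : W.CoordinateRing →ₐ[F] K, φ (mk W (C X)) = x ∧ φ (mk W Y) = y := by
  have h0 : eval₂ (aeval (R := F) x : F[X] →ₐ[F] K).toRingHom y W.polynomial = 0 := by
    rw [equation_iff'] at h
    rw [← h, Affine.polynomial]
    simp [eval₂_pow]
    ring
  refine ⟨⟨AdjoinRoot.lift (aeval x : F[X] →ₐ[F] K).toRingHom y h0, fun r ↦ ?_⟩, ?_, ?_⟩
  · change AdjoinRoot.lift (aeval x : F[X] →ₐ[F] K).toRingHom y h0 (mk W (C (C r))) = _
    rw [AdjoinRoot.lift_mk, eval₂_C]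
    exact aeval_C x r
  · change AdjoinRoot.lift (aeval x : F[X] →ₐ[F] K).toRingHom y h0 (mk W (C X)) = _
    rw [AdjoinRoot.lift_mk, eval₂_C]
    exact aeval_X x
  · change AdjoinRoot.lift (aeval x : F[X] →ₐ[F] K).toRingHom y h0 (mk W Y) = _
    rw [AdjoinRoot.lift_mk, eval₂_X]

variable (W K) in
/-- The `K`-points of the affine curve. -/
noncomputable def algHomEquiv : (W.CoordinateRing →ₐ[F] K) ≃
    {xy : K × K // (W.map (algebraMap F K)).Equation xy.1 xy.2} :=
  Equiv.ofBijective (fun φ ↦ ⟨(φ (mk W (C X)), φ (mk W Y)), equation_algHom φ⟩) <| by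
    constructor
    · intro φ ψ h
      rw [Subtype.mk.injEq, Prod.mk.injEq] at h
      exact algHom_ext h.1 h.2
    · rintro ⟨⟨x, y⟩, h⟩
      obtain ⟨φ, hx, hy⟩ := exists_algHom h
      exact ⟨φ, Subtype.ext (Prod.ext hx hy)⟩

variable (W) [Finite K] [W.IsElliptic]

/-- The summand `1` is the point at infinity. -/
theorem card_point [Finite F] :
    Nat.card (W.map (algebraMap F K)).Point =
      primeCodimSum F W.CoordinateRing (Module.finrank F K) + 1 := by
  have := Finite.of_equiv _ (algHomEquiv W K).symm
  rw [← card_algHom (genusOneFiltration W).finite_ofCodim, Nat.card_congr (algHomEquiv W K),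
    Nat.card_congr (pointEquiv _)]
  exact Finite.card_option

end Points

end WeierstrassCurve.Affine.CoordinateRing

/-! ### Solving the recursion for the point counts. -/

section Trace

/-- The sums of powers `α ^ n + β ^ n`, where `α + β = s` and `α * β = q`. -/
def powerSumSeq {R : Type*} [CommRing R] (s q : R) : ℕ → R
  | 0 => 2
  | 1 => s
  | n + 2 => s * powerSumSeq s q (n + 1) - q * powerSumSeq s q n

lemma map_powerSumSeq {R S : Type*} [CommRing R] [CommRing S] (f : R →+* S) (s q : R) :
    ∀ n, f (powerSumSeq s q n) = powerSumSeq (f s) (f q) n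
  | 0 => map_ofNat f 2
  | 1 => rfl
  | n + 2 => by
    rw [powerSumSeq, powerSumSeq, map_sub, map_mul, map_mul, map_powerSumSeq f s q (n + 1),
      map_powerSumSeq f s q n]

lemma powerSumSeq_eq {R : Type*} [CommRing R] (α β : R) :
    ∀ n, powerSumSeq (α + β) (α * β) n = α ^ n + β ^ n
  | 0 => by rw [powerSumSeq]; ring
  | 1 => by rw [powerSumSeq]; ring
  | n + 2 => by
    rw [powerSumSeq, powerSumSeq_eq α β (n + 1), powerSumSeq_eq α β n]
    ring

variable {a : ℕ → ℤ} {q : ℤ}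

/-- In generating functions, `∑ a n T ^ n = (1 - (q - a 1) T + q T ^ 2) / (1 - q T)`, and this is
its logarithmic derivative compared coefficientwise. -/
lemma sum_pow_sub_powerSumSeq (h0 : a 0 = 1) (ha : ∀ n, a (n + 2) = (1 + a 1) * q ^ (n + 1)) (n : ℕ) :
    ∑ i ∈ Finset.range (n + 1), (q ^ (i + 1) - powerSumSeq (q - a 1) q (i + 1)) * a (n - i) =
      (n + 1) * a (n + 1) := by
  obtain ⟨T, hT⟩ : ∃ T : ℕ → ℤ, ∀ i, T i = q ^ (i + 1) - powerSumSeq (q - a 1) q (i + 1) :=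
    ⟨_, fun _ ↦ rfl⟩
  have hT0 : T 0 = a 1 := by simp [hT, powerSumSeq]
  have hT1 : T 1 = q ^ 2 - ((q - a 1) ^ 2 - 2 * q) := by
    simp only [hT, powerSumSeq]
    ring
  have hT2 : ∀ n, T (n + 2) = (q - a 1) * T (n + 1) - q * T n + q ^ (n + 2) * (1 + a 1) := fun n ↦ by
    simp only [hT, powerSumSeq]
    ring
  simp only [← hT]
  induction n with
  | zero =>
    rw [Finset.sum_range_one]
    change T 0 * a 0 = _
    rw [hT0, h0]
    simp
  | succ n ih =>
    cases n with
    | zero =>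
      rw [Finset.sum_range_succ, Finset.sum_range_one]
      change T 0 * a 1 + T 1 * a 0 = _
      rw [hT0, hT1, h0, ha 0]
      push_cast
      ring
    | succ m =>
      rw [Finset.sum_range_succ, Finset.sum_range_succ] at ih ⊢
      rw [Finset.sum_range_succ]
      have e0 : m + 1 + 1 - m = 2 := by lia
      have e1 : m + 1 + 1 - (m + 1) = 1 := by lia
      have e2 : m + 1 - m = 1 := by lia
      rw [e0, e1, Nat.sub_self, h0, ha 0]
      rw [e2, Nat.sub_self, h0] at ih
      -- Every index of `a` here is at least `2`, where `a` is geometric with ratio `q`.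
      have hsum : ∑ i ∈ Finset.range m, T i * a (m + 1 + 1 - i) =
          q * ∑ i ∈ Finset.range m, T i * a (m + 1 - i) := by
        rw [Finset.mul_sum]
        refine Finset.sum_congr rfl fun i hi ↦ ?_
        rw [Finset.mem_range] at hi
        obtain ⟨d, rfl⟩ : ∃ d, m = i + d + 1 := ⟨m - i - 1, by lia⟩
        rw [show i + d + 1 + 1 + 1 - i = d + 1 + 2 by lia, show i + d + 1 + 1 - i = d + 2 by lia,
          ha, ha]
        ring
      rw [show m + 1 + 1 = m + 2 from rfl] at *
      rw [hT2 m, show m + 2 + 1 = (m + 1) + 2 from rfl, ha (m + 1), hsum]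
      rw [ha m] at ih
      push_cast at ih ⊢
      linear_combination q * ih

/-- As `a 0 = 1`, the recursion determines `S` successively, so `S` agrees with the solution found
above. -/
lemma eq_pow_sub_powerSumSeq (h0 : a 0 = 1) (ha : ∀ n, a (n + 2) = (1 + a 1) * q ^ (n + 1))
    {S : ℕ → ℤ} (hS : ∀ n, n * a n = ∑ j ∈ Finset.Icc 1 n, S j * a (n - j)) (n : ℕ) :
    S (n + 1) = q ^ (n + 1) - powerSumSeq (q - a 1) q (n + 1) := by
  induction n using Nat.strong_induction_on with
  | _ n ih =>
    have h1 := sum_pow_sub_powerSumSeq h0 ha n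
    have h2 := hS (n + 1)
    have h3 : ∑ j ∈ Finset.Icc 1 (n + 1), S j * a (n + 1 - j) =
        ∑ i ∈ Finset.range (n + 1), S (i + 1) * a (n - i) := by
      rw [← Finset.Ico_add_one_right_eq_Icc, Finset.sum_Ico_eq_sum_range]
      exact Finset.sum_congr rfl fun i _ ↦ by
        rw [add_comm 1 i, Nat.add_sub_add_right]
    rw [h3, Finset.sum_range_succ, Nat.sub_self, h0] at h2
    rw [Finset.sum_range_succ, Nat.sub_self, h0] at h1
    have h4 : ∑ i ∈ Finset.range n, S (i + 1) * a (n - i) = ∑ i ∈ Finset.range n,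
        (q ^ (i + 1) - powerSumSeq (q - a 1) q (i + 1)) * a (n - i) :=
      Finset.sum_congr rfl fun i hi ↦ by rw [ih i (Finset.mem_range.1 hi)]
    push_cast at h2
    linear_combination -h1 - h2 - h4

end Trace

/-! ### The point count over an extension. -/

namespace WeierstrassCurve

open Ideal Affine.CoordinateRing

theorem card_point_baseChange {F K : Type*} [Field F] [Finite F] [Field K] [Finite K] [Algebra F K]
    (E : WeierstrassCurve F) [E.IsElliptic] :
    (Nat.card (E.baseChange K).toAffine.Point : ℤ) =
      1 + (Nat.card F : ℤ) ^ Module.finrank F K -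
        powerSumSeq (1 + (Nat.card F : ℤ) - Nat.card E.toAffine.Point) (Nat.card F)
          (Module.finrank F K) := by
  have hV := genusOneFiltration E.toAffine
  let A : ℕ → ℕ := fun n ↦ (ofCodim F E.toAffine.CoordinateRing n).ncard
  let S := primeCodimSum F E.toAffine.CoordinateRing
  have hA0 : A 0 = 1 := by simp only [A, ofCodim_zero, Set.ncard_singleton]
  have hA : ∀ n, A (n + 2) = (1 + A 1) * Nat.card F ^ (n + 1) := fun n ↦
    hV.ncard_ofCodim (by lia)
  have hE : ∀ n, n * A n = ∑ j ∈ Finset.Icc 1 n, S j * A (n - j) :=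
    mul_ncard_ofCodim hV.finite_ofCodim
  have hA1 : A 1 = S 1 := by simpa [hA0] using hE 1
  have hF : Nat.card E.toAffine.Point = S 1 + 1 := by
    have h := card_point E.toAffine (K := F)
    rw [Module.finrank_self, Algebra.algebraMap_self] at h
    rw [← h]
    congr 2
  have hpos : 1 ≤ Module.finrank F K := Module.finrank_pos
  obtain ⟨k, hk⟩ : ∃ k, Module.finrank F K = k + 1 := ⟨_, (Nat.sub_add_cancel hpos).symm⟩
  have hK : Nat.card (E.baseChange K).toAffine.Point = S (k + 1) + 1 := by
    rw [← hk]
    exact card_point E.toAffine (K := K)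
  have key := eq_pow_sub_powerSumSeq (a := fun n ↦ (A n : ℤ)) (q := Nat.card F)
    (S := fun n ↦ (S n : ℤ)) (by simp [hA0]) (fun n ↦ by simp only [hA]; push_cast; rfl)
    (fun n ↦ by exact_mod_cast hE n) k
  rw [hK, hF, hk]
  push_cast
  rw [key, hA1, show (1 + (Nat.card F : ℤ) - (S 1 + 1)) = Nat.card F - S 1 by ring]
  ring

end WeierstrassCurve

/-! ### Polynomials vanishing along powers of independent numbers. -/

section MultiplicativeIndependence

/-- Distinct monomials take distinct values at `(α, β)`, hence give distinct characters `n ↦ z ^ n`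
of `ℕ`, which are linearly independent. -/
lemma MvPolynomial.eq_zero_of_forall_eval_pow {Q : MvPolynomial (Fin 2) ℂ} {α β : ℂ}
    (hα : α ≠ 0) (hβ : β ≠ 0)
    (hinj : ∀ i j k l : ℕ, α ^ i * β ^ j = α ^ k * β ^ l → i = k ∧ j = l)
    (h : ∀ n : ℕ, eval ![α ^ (n + 1), β ^ (n + 1)] Q = 0) : Q = 0 := by
  let z : (Fin 2 →₀ ℕ) → ℂ := fun m ↦ α ^ m 0 * β ^ m 1
  have hz : ∀ m, z m ≠ 0 := fun m ↦ mul_ne_zero (pow_ne_zero _ hα) (pow_ne_zero _ hβ)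
  have hzinj : Function.Injective z := by
    intro m m' hm
    obtain ⟨h0, h1⟩ := hinj _ _ _ _ hm
    ext i
    fin_cases i
    exacts [h0, h1]
  have hli := (linearIndependent_monoidHom (Multiplicative ℕ) ℂ).comp (fun m ↦ powersHom ℂ (z m))
    ((powersHom ℂ).injective.comp hzinj)
  rw [linearIndependent_iff'] at hli
  have hsum := hli Q.support (fun m ↦ coeff m Q * z m) (by
    funext n
    simp only [Finset.sum_apply, Pi.smul_apply, Function.comp_apply, powersHom_apply, smul_eq_mul,
      Pi.zero_apply]
    rw [← h n.toAdd, eval_eq']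
    refine Finset.sum_congr rfl fun m _ ↦ ?_
    simp only [Fin.prod_univ_two, Matrix.cons_val_zero, Matrix.cons_val_one, z]
    ring)
  ext m
  rw [coeff_zero]
  by_contra hm
  exact mul_ne_zero hm (hz m) (hsum m (mem_support_iff.2 hm))

lemma odd_powerSumSeq_one_two : ∀ n, Odd (powerSumSeq (1 : ℤ) 2 (n + 1))
  | 0 => odd_one
  | n + 1 => by
    rw [powerSumSeq, one_mul]
    exact (odd_powerSumSeq_one_two n).sub_even (even_two_mul _)

/-- Multiplying the relation by its conjugate gives `i + j = k + l`, which reduces it to `α ^ m = β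
^ m`. For `m ≥ 1` this would make `(α ^ m + β ^ m) ^ 2 = 4 * 2 ^ m` even, although `α ^ m + β ^ m`
is an odd integer. -/
lemma eq_of_pow_mul_pow_eq {α : ℂ} (h1 : α + starRingEnd ℂ α = 1) (h2 : α * starRingEnd ℂ α = 2)
    {i j k l : ℕ} (h : α ^ i * starRingEnd ℂ α ^ j = α ^ k * starRingEnd ℂ α ^ l) :
    i = k ∧ j = l := by
  set β := starRingEnd ℂ α with hβ
  have hα0 : α ≠ 0 := by rintro h0; simp [h0] at h2
  have hβ0 : β ≠ 0 := by rintro h0; simp [h0] at h2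
  have hsum : i + j = k + l := by
    have h3 := congr_arg (starRingEnd ℂ) h
    simp only [map_mul, map_pow, hβ, Complex.conj_conj] at h3
    rw [← hβ] at h3
    have h4 : (2 : ℂ) ^ (i + j) = 2 ^ (k + l) := by
      rw [← h2, mul_pow, mul_pow]
      calc α ^ (i + j) * β ^ (i + j) = (α ^ i * β ^ j) * (β ^ i * α ^ j) := by ring
        _ = α ^ (k + l) * β ^ (k + l) := by rw [h, h3]; ring
    exact Nat.pow_right_injective le_rfl (by exact_mod_cast h4)
  have key : ∀ m, α ^ m = β ^ m → m = 0 := by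
    intro m hm
    by_contra hm0
    obtain ⟨n, rfl⟩ := Nat.exists_eq_add_one_of_ne_zero hm0
    have h5 : ((powerSumSeq (1 : ℤ) 2 (n + 1) : ℤ) : ℂ) = α ^ (n + 1) + β ^ (n + 1) := by
      rw [← powerSumSeq_eq, h1, h2]
      simpa using map_powerSumSeq (Int.castRingHom ℂ) 1 2 (n + 1)
    have h6 : ((powerSumSeq (1 : ℤ) 2 (n + 1) : ℤ) : ℂ) ^ 2 = 4 * 2 ^ (n + 1) := by
      rw [h5, ← h2, mul_pow]
      linear_combination (α ^ (n + 1) - β ^ (n + 1)) * hm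
    have h7 : powerSumSeq (1 : ℤ) 2 (n + 1) ^ 2 = 2 * (2 * 2 ^ (n + 1)) := by
      have : powerSumSeq (1 : ℤ) 2 (n + 1) ^ 2 = 4 * 2 ^ (n + 1) := by exact_mod_cast h6
      rw [this]
      ring
    exact Int.not_even_iff_odd.2 ((odd_powerSumSeq_one_two n).pow) (h7 ▸ even_two_mul _)
  rcases le_total i k with hik | hik
  · obtain ⟨m, rfl⟩ := Nat.exists_eq_add_of_le hik
    obtain rfl : j = l + m := by lia
    have : m = 0 := key m <| by
      refine mul_left_cancel₀ (mul_ne_zero (pow_ne_zero i hα0) (pow_ne_zero l hβ0)) ?_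
      linear_combination -h
    lia
  · obtain ⟨m, rfl⟩ := Nat.exists_eq_add_of_le hik
    obtain rfl : l = j + m := by lia
    have : m = 0 := key m <| by
      refine mul_left_cancel₀ (mul_ne_zero (pow_ne_zero k hα0) (pow_ne_zero j hβ0)) ?_
      linear_combination h
    lia

end MultiplicativeIndependence

/-- A polynomial in two variables vanishing at all `(2 ^ n, 1 + 2 ^ n - (α ^ n + β ^ n))`, where
`α` and `β` are the roots of `X ^ 2 - X + 2`, is zero. -/
theorem MvPolynomial.eq_zero_of_forall_eval_powerSumSeq {D : MvPolynomial (Fin 2) ℤ}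
    (h : ∀ n : ℕ, eval ![(2 : ℤ) ^ (n + 1),
      1 + 2 ^ (n + 1) - powerSumSeq (1 : ℤ) 2 (n + 1)] D = 0) : D = 0 := by
  obtain ⟨α, h1, h2⟩ : ∃ α : ℂ, α + starRingEnd ℂ α = 1 ∧ α * starRingEnd ℂ α = 2 := by
    refine ⟨⟨1 / 2, √7 / 2⟩, ?_, ?_⟩
    · apply Complex.ext <;> norm_num
    · rw [Complex.mul_conj, Complex.normSq_mk, div_mul_div_comm, div_mul_div_comm,
        Real.mul_self_sqrt (by norm_num)]
      norm_num
  set β := starRingEnd ℂ α with hβ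
  have hα0 : α ≠ 0 := by rintro h0; simp [h0] at h2
  have hβ0 : β ≠ 0 := by rintro h0; simp [h0] at h2
  -- In the coordinates `x`, `y` with `q = x y` and `N = (1 - x) (1 - y)`, the given points become
  -- `(α ^ n, β ^ n)`.
  let Q : MvPolynomial (Fin 2) ℂ := aeval ![X 0 * X 1, (1 - X 0) * (1 - X 1)] D
  have hQeval : ∀ x y : ℂ, eval ![x, y] Q = aeval ![x * y, (1 - x) * (1 - y)] D := by
    intro x y
    have : ((eval ![x, y]).comp (aeval ![X 0 * X 1, (1 - X 0) * (1 - X 1)] :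
        MvPolynomial (Fin 2) ℤ →ₐ[ℤ] MvPolynomial (Fin 2) ℂ).toRingHom) =
        (aeval ![x * y, (1 - x) * (1 - y)] : MvPolynomial (Fin 2) ℤ →ₐ[ℤ] ℂ).toRingHom := by
      apply MvPolynomial.ringHom_ext
      · intro r; simp
      · intro i
        fin_cases i <;> simp
    exact DFunLike.congr_fun this D
  have hcast : ∀ u v : ℤ, aeval ![(u : ℂ), (v : ℂ)] D = ((eval ![u, v] D : ℤ) : ℂ) := by
    intro u v
    have : (aeval ![(u : ℂ), (v : ℂ)] : MvPolynomial (Fin 2) ℤ →ₐ[ℤ] ℂ).toRingHom =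
        (Int.castRingHom ℂ).comp (eval ![u, v]) := by
      apply MvPolynomial.ringHom_ext
      · intro r; simp
      · intro i
        fin_cases i <;> simp
    exact DFunLike.congr_fun this D
  have hQ : Q = 0 := by
    refine eq_zero_of_forall_eval_pow hα0 hβ0 (fun i j k l ↦ eq_of_pow_mul_pow_eq h1 h2) fun n ↦ ?_
    have h3 := hcast (2 ^ (n + 1)) (1 + 2 ^ (n + 1) - powerSumSeq 1 2 (n + 1))
    rw [h n, Int.cast_zero] at h3
    rw [hQeval, ← h3]
    have h5 : ((powerSumSeq (1 : ℤ) 2 (n + 1) : ℤ) : ℂ) = α ^ (n + 1) + β ^ (n + 1) := by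
      rw [← powerSumSeq_eq, h1, h2]
      simpa using map_powerSumSeq (Int.castRingHom ℂ) 1 2 (n + 1)
    congr 2
    push_cast
    rw [h5, ← h2]
    congr 1
    · ring
    · congr 1
      ring
  apply MvPolynomial.map_injective (Int.castRingHom ℂ) Int.cast_injective
  rw [map_zero]
  refine MvPolynomial.funext fun w ↦ ?_
  rw [map_zero, eval_map]
  -- The change of coordinates is surjective on `ℂ ^ 2`: take for `x`, `y` the roots of `X ^ 2 - (1
  -- + w 0 - w 1) X + w 0`.
  obtain ⟨s, hs⟩ := IsAlgClosed.exists_pow_nat_eq ((1 + w 0 - w 1) ^ 2 - 4 * w 0) two_pos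
  have h4 := hQeval ((1 + w 0 - w 1 + s) / 2) ((1 + w 0 - w 1 - s) / 2)
  rw [hQ, map_zero] at h4
  rw [h4, aeval_def]
  congr 1
  funext i
  fin_cases i
  · simp
    linear_combination hs / 4
  · simp
    linear_combination hs / 4

/-! ### Existence and uniqueness of the polynomial. -/

section Uniqueness

/-- The polynomial `1 + q ^ k - (α ^ k + β ^ k)` in `q` and `N`, where `α + β = 1 + q - N` and
`α * β = q`. -/
noncomputable def pointCountPolynomial (k : ℕ) : MvPolynomial (Fin 2) ℤ :=
  1 + MvPolynomial.X 0 ^ k -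
    powerSumSeq (1 + MvPolynomial.X 0 - MvPolynomial.X 1) (MvPolynomial.X 0) k

lemma eval_pointCountPolynomial (k : ℕ) (q N : ℤ) :
    MvPolynomial.eval ![q, N] (pointCountPolynomial k) =
      1 + q ^ k - powerSumSeq (1 + q - N) q k := by
  simp [pointCountPolynomial, map_powerSumSeq]

theorem expressesPointCount_pointCountPolynomial (k : ℕ) [NeZero k] :
    ExpressesPointCount k (pointCountPolynomial k) := by
  intro F K _ _ _ _ hk E _
  have : Module.Finite F K := Module.finite_of_finrank_pos (by rw [hk]; exact NeZero.pos k)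
  have := Module.finite_of_finite F (M := K)
  rw [eval_pointCountPolynomial, WeierstrassCurve.card_point_baseChange, hk]

lemma eval_eq_zero_of_expresses {k : ℕ} [NeZero k] {N N' : MvPolynomial (Fin 2) ℤ}
    (h : ExpressesPointCount k N) (h' : ExpressesPointCount k N') {F : Type} [Field F] [Finite F]
    (E : WeierstrassCurve F) [E.IsElliptic] :
    MvPolynomial.eval ![(Nat.card F : ℤ), (Nat.card E.toAffine.Point : ℤ)] (N - N') = 0 := by
  obtain ⟨p, hp⟩ := CharP.exists F
  have : Fact p.Prime := ⟨CharP.char_is_prime F p⟩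
  have hk := FiniteField.finrank_extension F p k
  rw [map_sub, ← h F _ hk E, ← h' F _ hk E, sub_self]

/-- Both polynomials are compared on the base change of `E` to the extension of degree `n`, whose
point count is known. -/
lemma eval_pow_eq_zero_of_expresses {k : ℕ} [NeZero k] {N N' : MvPolynomial (Fin 2) ℤ}
    (h : ExpressesPointCount k N) (h' : ExpressesPointCount k N') {F : Type} [Field F] [Finite F]
    (E : WeierstrassCurve F) [E.IsElliptic] (n : ℕ) [NeZero n] :
    MvPolynomial.eval ![(Nat.card F : ℤ) ^ n, 1 + (Nat.card F : ℤ) ^ n -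
      powerSumSeq (1 + (Nat.card F : ℤ) - Nat.card E.toAffine.Point) (Nat.card F) n] (N - N') = 0 := by
  obtain ⟨p, hp⟩ := CharP.exists F
  have : Fact p.Prime := ⟨CharP.char_is_prime F p⟩
  have hE := E.card_point_baseChange (K := FiniteField.Extension F p n)
  have : (E.baseChange (FiniteField.Extension F p n)).IsElliptic :=
    inferInstanceAs (E.map (algebraMap F (FiniteField.Extension F p n))).IsElliptic
  have h0 := eval_eq_zero_of_expresses h h' (E.baseChange (FiniteField.Extension F p n))
  rw [hE, FiniteField.finrank_extension, FiniteField.natCard_extension] at h0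
  exact_mod_cast h0

/-- The curve `y ^ 2 + x * y = x ^ 3 + x ^ 2 + 1` over the field with two elements. -/
def ordinaryCurve : WeierstrassCurve (ZMod 2) := ⟨1, 1, 0, 0, 1⟩

instance : ordinaryCurve.IsElliptic := ⟨by
  rw [isUnit_iff_ne_zero]
  decide⟩

lemma card_point_ordinaryCurve : Nat.card ordinaryCurve.toAffine.Point = 2 := by
  rw [Nat.card_congr (WeierstrassCurve.Affine.pointEquiv _)]
  have h : ∀ xy : ZMod 2 × ZMod 2,
      ordinaryCurve.toAffine.Equation xy.1 xy.2 ↔ xy = (0, 1) := by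
    intro xy
    rw [WeierstrassCurve.Affine.equation_iff]
    revert xy
    decide
  have hu : Unique {xy : ZMod 2 × ZMod 2 // ordinaryCurve.toAffine.Equation xy.1 xy.2} :=
    ⟨⟨⟨(0, 1), (h _).2 rfl⟩⟩, fun xy ↦ Subtype.ext ((h _).1 xy.2)⟩
  have h2 : Nat.card (Option {xy : ZMod 2 × ZMod 2 // ordinaryCurve.toAffine.Equation xy.1 xy.2}) =
      1 + 1 := by rw [Finite.card_option, Nat.card_unique]
  exact h2

theorem expressesPointCount_unique {k : ℕ} [NeZero k] {N N' : MvPolynomial (Fin 2) ℤ}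
    (h : ExpressesPointCount k N) (h' : ExpressesPointCount k N') : N = N' := by
  rw [← sub_eq_zero]
  refine MvPolynomial.eq_zero_of_forall_eval_powerSumSeq fun n ↦ ?_
  have h0 := eval_pow_eq_zero_of_expresses h h' ordinaryCurve (n + 1)
  rw [card_point_ordinaryCurve, Nat.card_zmod] at h0
  norm_num at h0 ⊢
  exact h0

theorem existsUnique_expressesPointCount (k : ℕ) [NeZero k] :
    ∃! N : MvPolynomial (Fin 2) ℤ, ExpressesPointCount k N :=
  ⟨_, expressesPointCount_pointCountPolynomial k,
    fun _ h ↦ expressesPointCount_unique h (expressesPointCount_pointCountPolynomial k)⟩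

end Uniqueness

/-! ### Chip-firing and the lattice of firings. -/

namespace ChipFiring

variable {V : Type*} [Fintype V]

/-- `D i` is the vector of chips lost by each vertex when `i` fires: vertices other than `i` do not
lose chips, chips leave the system with every firing, and firing all vertices once costs every vertex
at least one chip. -/
structure IsFiringMatrix (D : V → V → ℤ) : Prop where
  nonpos : ∀ i j, i ≠ j → D i j ≤ 0
  leak : ∀ i, 0 < ∑ j, D i j
  sum_pos : ∀ j, 0 < (∑ i, D i) j

/-- Legal firing of a vertex other than the bank. -/
def FireStep (D : V → V → ℤ) (x y : V → ℤ) : Prop :=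
  ∃ i, D i i ≤ x i ∧ y = x - D i

/-- No vertex other than the bank can fire. -/
def Stable (D : V → V → ℤ) (x : V → ℤ) : Prop :=
  ∀ i, x i < D i i

/-- A firing of any vertex, where the bank fires only in stable positions. -/
def GameStep (D : V → V → ℤ) (x y : V → ℤ) : Prop :=
  FireStep D x y ∨ Stable D x ∧ y = x + ∑ i, D i

/-- Reachability by legal firings of vertices other than the bank. -/
abbrev Reach (D : V → V → ℤ) : (V → ℤ) → (V → ℤ) → Prop :=
  Relation.ReflTransGen (FireStep D)

variable {D : V → V → ℤ}

lemma IsFiringMatrix.diag_pos (hD : IsFiringMatrix D) (i : V) : 0 < D i i := by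
  classical
  have h := hD.leak i
  rw [← Finset.add_sum_erase _ _ (Finset.mem_univ i)] at h
  have h2 : ∑ j ∈ Finset.univ.erase i, D i j ≤ 0 :=
    Finset.sum_nonpos fun j hj ↦ hD.nonpos i j (Finset.ne_of_mem_erase hj).symm
  linarith

omit [Fintype V] in
lemma Stable.not_fireStep {x y : V → ℤ} (hx : Stable D x) : ¬ FireStep D x y := by
  rintro ⟨i, hi, -⟩
  exact (hx i).not_ge hi

omit [Fintype V] in
lemma Stable.eq_of_reach {x y : V → ℤ} (hx : Stable D x) (h : Reach D x y) : x = y := by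
  rcases Relation.ReflTransGen.cases_head h with rfl | ⟨z, hz, -⟩
  · rfl
  · exact (hx.not_fireStep hz).elim

lemma FireStep.nonneg (hD : IsFiringMatrix D) {x y : V → ℤ} (h : FireStep D x y)
    (hx : 0 ≤ x) : 0 ≤ y := by
  obtain ⟨i, hi, rfl⟩ := h
  intro j
  rw [Pi.zero_apply, Pi.sub_apply, sub_nonneg]
  by_cases hij : i = j
  · exact hij ▸ hi
  · exact (hD.nonpos i j hij).trans (hx j)

/-- Each firing lowers the nonnegative total number of chips. -/
lemma exists_reach_stable (hD : IsFiringMatrix D) {x : V → ℤ} (hx : 0 ≤ x) :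
    ∃ y, Reach D x y ∧ Stable D y ∧ 0 ≤ y := by
  obtain ⟨n, hn⟩ : ∃ n : ℕ, ∑ i, x i ≤ n := ⟨(∑ i, x i).toNat, Int.self_le_toNat _⟩
  induction n using Nat.strong_induction_on generalizing x with
  | _ n ih =>
    by_cases hs : Stable D x
    · exact ⟨x, .refl, hs, hx⟩
    · obtain ⟨i, hi⟩ := not_forall.1 hs
      have hstep : FireStep D x (x - D i) := ⟨i, not_lt.1 hi, rfl⟩
      have hy := hstep.nonneg hD hx
      have hsum : ∑ j, (x - D i) j = ∑ j, x j - ∑ j, D i j := by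
        simp only [Pi.sub_apply, Finset.sum_sub_distrib]
      have hle := hD.leak i
      have hnn : 0 ≤ ∑ j, (x - D i) j := Finset.sum_nonneg fun j _ ↦ hy j
      obtain ⟨y, hxy, hys⟩ := ih (n - 1) (by lia) hy (by lia)
      exact ⟨y, .head hstep hxy, hys⟩

/-- Firing one vertex takes no chips from another, so two different legal firings commute; the
Church-Rosser theorem applies. -/
lemma reach_join (hD : IsFiringMatrix D) {x y z : V → ℤ} (hy : Reach D x y) (hz : Reach D x z) :
    Relation.Join (Reach D) y z := by
  refine Relation.church_rosser (fun a b c hab hac ↦ ?_) hy hz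
  obtain ⟨i, hi, rfl⟩ := hab
  obtain ⟨j, hj, rfl⟩ := hac
  by_cases hij : i = j
  · subst hij
    exact ⟨_, .refl, .refl⟩
  · refine ⟨a - D i - D j, .single ⟨j, ?_, rfl⟩, .single ⟨i, ?_, sub_right_comm _ _ _⟩⟩
    · have := hD.nonpos i j hij
      rw [Pi.sub_apply]
      linarith
    · have := hD.nonpos j i (Ne.symm hij)
      rw [Pi.sub_apply]
      linarith

lemma Stable.reach_unique (hD : IsFiringMatrix D) {x y z : V → ℤ} (hy : Reach D x y)
    (hz : Reach D x z) (hys : Stable D y) (hzs : Stable D z) : y = z := by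
  obtain ⟨w, hyw, hzw⟩ := reach_join hD hy hz
  rw [hys.eq_of_reach hyw, hzs.eq_of_reach hzw]

omit [Fintype V] in
lemma Reach.add_right {x y d : V → ℤ} (h : Reach D x y) (hd : 0 ≤ d) :
    Reach D (x + d) (y + d) := by
  refine Relation.ReflTransGen.lift (· + d) ?_ _ _ h
  rintro a b ⟨i, hi, rfl⟩
  exact ⟨i, hi.trans (le_add_of_nonneg_right (hd i)), sub_add_eq_add_sub _ _ _⟩

lemma reach_sub_sum (hD : IsFiringMatrix D) (l : List V) {x : V → ℤ}
    (hx : ∀ i, (l.map fun v ↦ D v v).sum ≤ x i) : Reach D x (x - (l.map D).sum) := by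
  induction l generalizing x with
  | nil => simpa using Relation.ReflTransGen.refl
  | cons v l ih =>
    simp only [List.map_cons, List.sum_cons] at hx ⊢
    have hnn : 0 ≤ (l.map fun v ↦ D v v).sum := List.sum_nonneg fun a ha ↦ by
      obtain ⟨w, -, rfl⟩ := List.mem_map.1 ha
      exact (hD.diag_pos w).le
    rw [← sub_sub]
    refine .head ⟨v, by linarith [hx v], rfl⟩ (ih fun i ↦ ?_)
    have h1 := hx i
    rw [Pi.sub_apply]
    by_cases hvi : v = i
    · subst hvi; linarith
    · have := hD.nonpos v i hvi
      have := hD.diag_pos v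
      linarith

omit [Fintype V] in
lemma exists_lists_of_mem_span {w : V → ℤ} (hw : w ∈ Submodule.span ℤ (Set.range D)) :
    ∃ l l' : List V, w = (l.map D).sum - (l'.map D).sum := by
  rw [← Submodule.mem_toAddSubgroup, Submodule.span_int_eq_addSubgroupClosure] at hw
  induction hw using AddSubgroup.closure_induction with
  | mem w hw =>
    obtain ⟨i, rfl⟩ := hw
    exact ⟨[i], [], by simp⟩
  | zero => exact ⟨[], [], by simp⟩
  | add a b _ _ ha hb =>
    obtain ⟨l₁, l₁', rfl⟩ := ha
    obtain ⟨l₂, l₂', rfl⟩ := hb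
    exact ⟨l₁ ++ l₂, l₁' ++ l₂', by simp only [List.map_append, List.sum_append]; abel⟩
  | neg a _ ha =>
    obtain ⟨l, l', rfl⟩ := ha
    exact ⟨l', l, by abel⟩

omit [Fintype V] in
lemma Reach.sub_mem_span {x y : V → ℤ} (h : Reach D x y) :
    x - y ∈ Submodule.span ℤ (Set.range D) := by
  induction h with
  | refl => rw [sub_self]; exact zero_mem _
  | tail _ h ih =>
    obtain ⟨i, -, rfl⟩ := h
    rw [← sub_add]
    exact add_mem ih (Submodule.subset_span ⟨i, rfl⟩)

/-- Extra chips keep the other firings legal, so all firings of the bank can be moved to the front.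
-/
lemma exists_reach_of_gameStep (hD : IsFiringMatrix D) {x y : V → ℤ}
    (h : Relation.ReflTransGen (GameStep D) x y) :
    ∃ n : ℕ, Reach D (x + n • ∑ i, D i) y := by
  induction h with
  | refl => exact ⟨0, by rw [zero_smul, add_zero]⟩
  | tail _ h ih =>
    obtain ⟨n, hn⟩ := ih
    rcases h with h | ⟨-, rfl⟩
    · exact ⟨n, hn.tail h⟩
    · refine ⟨n + 1, ?_⟩
      rw [succ_nsmul, ← add_assoc]
      exact hn.add_right fun j ↦ (hD.sum_pos j).le

lemma exists_reach_of_recurrent (hD : IsFiringMatrix D) {x : V → ℤ} (hx : Stable D x)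
    (h : Relation.TransGen (GameStep D) x x) : ∃ n : ℕ, 0 < n ∧ Reach D (x + n • ∑ i, D i) x := by
  obtain ⟨z, hxz, hzx⟩ := Relation.TransGen.head'_iff.1 h
  rcases hxz with hxz | ⟨-, rfl⟩
  · exact (hx.not_fireStep hxz).elim
  · obtain ⟨n, hn⟩ := exists_reach_of_gameStep hD hzx
    refine ⟨n + 1, n.succ_pos, ?_⟩
    rwa [succ_nsmul', ← add_assoc]

lemma reach_mul_nsmul (hD : IsFiringMatrix D) {x : V → ℤ} {n : ℕ}
    (h : Reach D (x + n • ∑ i, D i) x) (m : ℕ) : Reach D (x + (m * n) • ∑ i, D i) x := by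
  induction m with
  | zero => rw [zero_mul, zero_smul, add_zero]
  | succ m ih =>
    rw [add_mul, one_mul, add_smul, ← add_assoc]
    exact (ih.add_right (nsmul_nonneg (fun j ↦ (hD.sum_pos j).le) n)).trans h

lemma exists_le_nsmul (hD : IsFiringMatrix D) (x : V → ℤ) (c : ℤ) :
    ∃ N : ℕ, ∀ n, N ≤ n → ∀ i, c ≤ (x + n • ∑ i, D i) i := by
  refine ⟨∑ i, (c - x i).toNat, fun n hn i ↦ ?_⟩
  have h1 : (c - x i).toNat ≤ n :=
    (Finset.single_le_sum (f := fun i ↦ (c - x i).toNat) (fun _ _ ↦ Nat.zero_le _)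
      (Finset.mem_univ i)).trans hn
  have h2 := hD.sum_pos i
  rw [Pi.add_apply, Pi.smul_apply, nsmul_eq_mul]
  have h3 : (n : ℤ) ≤ n * (∑ i, D i) i := le_mul_of_one_le_right (Int.natCast_nonneg n) h2
  have h4 := Int.self_le_toNat (c - x i)
  lia

/-- Critical positions. -/
def IsCrit (D : V → V → ℤ) (x : V → ℤ) : Prop :=
  0 ≤ x ∧ Stable D x ∧ Relation.TransGen (GameStep D) x x

/-- Write `x - x'` as a difference of firings along lists `l` and `l'`. After enough bank firings
from `x` and `x'`, both lists can be fired legally and lead to one common position. The stable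
position reached is unique, and by recurrence it is both `x` and `x'`. -/
lemma IsCrit.eq_of_sub_mem_span (hD : IsFiringMatrix D) {x x' : V → ℤ} (hx : IsCrit D x)
    (hx' : IsCrit D x') (h : x - x' ∈ Submodule.span ℤ (Set.range D)) : x = x' := by
  obtain ⟨l, l', hll⟩ := exists_lists_of_mem_span h
  obtain ⟨n, hn0, hn⟩ := exists_reach_of_recurrent hD hx.2.1 hx.2.2
  obtain ⟨n', hn0', hn'⟩ := exists_reach_of_recurrent hD hx'.2.1 hx'.2.2
  obtain ⟨N₁, hN₁⟩ := exists_le_nsmul hD x (l.map fun v ↦ D v v).sum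
  obtain ⟨N₂, hN₂⟩ := exists_le_nsmul hD x' (l'.map fun v ↦ D v v).sum
  obtain ⟨N₃, hN₃⟩ := exists_le_nsmul hD x 0
  -- A common multiple of both recurrence periods that exceeds all the thresholds.
  set m := (N₁ + N₂ + N₃) * (n * n') with hm
  have hle : N₁ + N₂ + N₃ ≤ m := Nat.le_mul_of_pos_right _ (Nat.mul_pos hn0 hn0')
  have h1 : Reach D (x + m • ∑ i, D i) x := by
    have := reach_mul_nsmul hD hn ((N₁ + N₂ + N₃) * n')
    rwa [mul_assoc, mul_comm n'] at this
  have h2 : Reach D (x' + m • ∑ i, D i) x' := by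
    have := reach_mul_nsmul hD hn' ((N₁ + N₂ + N₃) * n)
    rwa [mul_assoc] at this
  have h3 := reach_sub_sum hD l (hN₁ m (by lia))
  have h4 := reach_sub_sum hD l' (hN₂ m (by lia))
  have heq : x' + m • ∑ i, D i - (l'.map D).sum = x + m • ∑ i, D i - (l.map D).sum := by
    rw [← sub_eq_zero, sub_eq_iff_eq_add.1 hll]
    abel
  rw [heq] at h4
  obtain ⟨y, hy, hys, -⟩ := exists_reach_stable hD (x := x + m • ∑ i, D i) (fun i ↦ hN₃ m (by lia) i)
  have hyx := Stable.reach_unique hD hy h1 hys hx.2.1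
  subst hyx
  obtain ⟨w, hw1, hw2⟩ := reach_join hD h1 h3
  rw [← hys.eq_of_reach hw1] at hw2
  exact Stable.reach_unique hD (h4.trans hw2) h2 hys hx'.2.1

/-- Letting the bank fire and then stabilising is a self-map of the finite set of stable positions
that preserves classes modulo the lattice. Its iterates eventually repeat, and a repeated position
is recurrent. -/
lemma exists_isCrit_sub_mem_span (hD : IsFiringMatrix D) (z : V → ℤ) :
    ∃ x, IsCrit D x ∧ x - z ∈ Submodule.span ℤ (Set.range D) := by
  set L := Submodule.span ℤ (Set.range D) with hL
  have hb : ∑ i, D i ∈ L := sum_mem fun i _ ↦ Submodule.subset_span ⟨i, rfl⟩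
  let S := {x : V → ℤ // 0 ≤ x ∧ Stable D x}
  have : Finite S := by
    classical
    refine ((Set.finite_Icc (0 : V → ℤ) fun i ↦ D i i).subset fun x hx ↦ ?_).to_subtype
    exact ⟨hx.1, fun i ↦ (hx.2 i).le⟩
  have hnext : ∀ x : S, ∃ y : S, Reach D (x.1 + ∑ i, D i) y.1 := fun x ↦ by
    obtain ⟨y, hy, hys, hy0⟩ := exists_reach_stable hD (x := x.1 + ∑ i, D i)
      (add_nonneg x.2.1 fun j ↦ (hD.sum_pos j).le)
    exact ⟨⟨y, hy0, hys⟩, hy⟩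
  choose T hT using hnext
  obtain ⟨N, hN⟩ := exists_le_nsmul hD z 0
  obtain ⟨y₀, hy₀, hys₀, hy0₀⟩ := exists_reach_stable hD (x := z + N • ∑ i, D i) (hN N le_rfl)
  let y : S := ⟨y₀, hy0₀, hys₀⟩
  have hclass : ∀ n, (T^[n] y).1 - z ∈ L := by
    intro n
    induction n with
    | zero =>
      have h1 := hy₀.sub_mem_span
      have h2 := sub_mem (nsmul_mem hb N) h1
      convert h2 using 1
      change y₀ - z = _
      abel
    | succ n ih =>
      rw [Function.iterate_succ_apply']
      have h1 := (hT (T^[n] y)).sub_mem_span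
      have h2 := sub_mem (add_mem ih hb) h1
      convert h2 using 1
      abel
  have hgame : ∀ x : S, Relation.TransGen (GameStep D) x.1 (T x).1 := fun x ↦
    .head' (Or.inr ⟨x.2.2, rfl⟩) (Relation.ReflTransGen.mono (fun _ _ h ↦ Or.inl h) _ _ (hT x))
  have hiter : ∀ (x : S) n, Relation.TransGen (GameStep D) x.1 (T^[n + 1] x).1 := fun x n ↦ by
    induction n with
    | zero => exact hgame x
    | succ n ih =>
      rw [Function.iterate_succ_apply']
      exact ih.trans (hgame _)
  obtain ⟨a, b, hab, heq⟩ : ∃ a b, a < b ∧ T^[a] y = T^[b] y := by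
    obtain ⟨a, b, hne, heq⟩ := Finite.exists_ne_map_eq_of_infinite fun n ↦ T^[n] y
    rcases hne.lt_or_gt with h | h
    · exact ⟨a, b, h, heq⟩
    · exact ⟨b, a, h, heq.symm⟩
  refine ⟨(T^[a] y).1, ⟨(T^[a] y).2.1, (T^[a] y).2.2, ?_⟩, hclass a⟩
  obtain ⟨d, rfl⟩ : ∃ d, b = d + 1 + a := ⟨b - a - 1, by lia⟩
  have h1 := hiter (T^[a] y) d
  rwa [← Function.iterate_add_apply, ← heq] at h1

theorem card_isCrit_eq_card_quotient (hD : IsFiringMatrix D) :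
    Nat.card {x // IsCrit D x} = Nat.card ((V → ℤ) ⧸ Submodule.span ℤ (Set.range D)) := by
  refine Nat.card_congr (Equiv.ofBijective (fun x ↦ Submodule.Quotient.mk x.1) ⟨?_, ?_⟩)
  · intro x x' h
    exact Subtype.ext (x.2.eq_of_sub_mem_span hD x'.2 ((Submodule.Quotient.eq _).1 h))
  · intro z
    obtain ⟨z, rfl⟩ := Submodule.Quotient.mk_surjective _ z
    obtain ⟨x, hx, hxz⟩ := exists_isCrit_sub_mem_span hD z
    exact ⟨⟨x, hx⟩, (Submodule.Quotient.eq _).2 hxz⟩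

/-- Positive row sums with nonpositive off-diagonal entries mean strict diagonal dominance. -/
lemma IsFiringMatrix.det_ne_zero [DecidableEq V] (hD : IsFiringMatrix D) :
    (Matrix.of D).det ≠ 0 := by
  have h : ((Matrix.of D).map (Int.castRingHom ℝ)).det ≠ 0 := by
    refine det_ne_zero_of_sum_row_lt_diag fun i ↦ ?_
    have h1 : ∀ j ∈ Finset.univ.erase i,
        ‖(Matrix.of D).map (Int.castRingHom ℝ) i j‖ = ((-D i j : ℤ) : ℝ) := fun j hj ↦ by
      have := hD.nonpos i j (Finset.ne_of_mem_erase hj).symm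
      simp only [Matrix.map_apply, Matrix.of_apply, eq_intCast, Real.norm_eq_abs]
      rw [abs_of_nonpos (by exact_mod_cast this)]
      push_cast; rfl
    have h2 : ‖(Matrix.of D).map (Int.castRingHom ℝ) i i‖ = ((D i i : ℤ) : ℝ) := by
      simp only [Matrix.map_apply, Matrix.of_apply, eq_intCast, Real.norm_eq_abs]
      exact abs_of_pos (by exact_mod_cast hD.diag_pos i)
    rw [Finset.sum_congr rfl h1, h2]
    have h3 := hD.leak i
    rw [← Finset.add_sum_erase _ _ (Finset.mem_univ i)] at h3
    have h4 : ∑ j ∈ Finset.univ.erase i, -D i j < D i i := by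
      rw [Finset.sum_neg_distrib]
      linarith
    exact_mod_cast h4
  rw [← RingHom.mapMatrix_apply, ← RingHom.map_det] at h
  exact fun h0 ↦ h (by rw [h0, map_zero])

/-- The number of critical positions is the determinant of the firing matrix. -/
theorem card_isCrit [DecidableEq V] (hD : IsFiringMatrix D) :
    Nat.card {x // IsCrit D x} = (Matrix.of D).det.natAbs := by
  have hli : LinearIndependent ℤ D := Matrix.linearIndependent_rows_of_det_ne_zero hD.det_ne_zero
  rw [card_isCrit_eq_card_quotient hD,
    ← Submodule.natAbs_det_basis_change (Pi.basisFun ℤ V) _ (Module.Basis.span hli), Pi.basisFun_det]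
  congr 2
  funext i
  exact congr_arg Subtype.val (Module.Basis.span_apply hli i)

end ChipFiring

/-! ### From the dollar game to firing matrices. -/

namespace MultiDigraph

open ChipFiring Relation

variable {V : Type} [Fintype V] [DecidableEq V]

/-- The firing matrix of the vertices other than the bank `none`. -/
def firingMatrix (G : MultiDigraph (Option V)) (i j : V) : ℤ :=
  if j = i then G.outDegree (some i) else -G.d (some i) (some j)

variable {G : MultiDigraph (Option V)}

lemma fire_some_comp (c : Option V → ℤ) (i : V) :
    (fun j ↦ G.fire (some i) c (some j)) = (fun j ↦ c (some j)) - G.firingMatrix i := by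
  funext j
  by_cases h : j = i
  · subst h
    simp [fire, firingMatrix]
  · simp [fire, firingMatrix, h]

lemma sum_fire (b : Option V) (c : Option V → ℤ) : ∑ v, G.fire b c v = ∑ v, c v := by
  rw [← Finset.add_sum_erase _ _ (Finset.mem_univ b), ← Finset.add_sum_erase _ c (Finset.mem_univ b)]
  have h : ∀ v ∈ Finset.univ.erase b, G.fire b c v = c v + G.d b v := fun v hv ↦
    if_neg (Finset.ne_of_mem_erase hv)
  rw [Finset.sum_congr rfl h, Finset.sum_add_distrib, fire, if_pos rfl, outDegree]
  push_cast
  ring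

lemma isStable_iff (c : Option V → ℤ) :
    G.IsStable none c ↔ Stable G.firingMatrix fun j ↦ c (some j) := by
  simp only [IsStable, Stable, firingMatrix, if_true, Option.forall, ne_eq, not_true_eq_false,
    IsEmpty.forall_iff, true_and, reduceCtorEq, not_false_eq_true, forall_const]

-- Away from the bank, a bank firing undoes one firing of each other vertex.
variable (hb : ∀ j, (G.d none (some j) : ℤ) = (∑ i, G.firingMatrix i) j)

include hb

lemma fire_none_comp (c : Option V → ℤ) :
    (fun j ↦ G.fire none c (some j)) = (fun j ↦ c (some j)) + ∑ i, G.firingMatrix i := by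
  funext j
  rw [Pi.add_apply, ← hb]
  simp [fire]

lemma Step.gameStep {c c' : Option V → ℤ} (h : G.Step none c c') :
    GameStep G.firingMatrix (fun j ↦ c (some j)) fun j ↦ c' (some j) := by
  obtain ⟨i, hi, rfl⟩ := h
  cases i with
  | none => exact Or.inr ⟨(isStable_iff c).1 (by simpa [CanFire] using hi), fire_none_comp hb c⟩
  | some i =>
    exact Or.inl ⟨i, by simpa [CanFire, firingMatrix] using hi, fire_some_comp c i⟩

lemma exists_step_of_gameStep {c : Option V → ℤ} {y : V → ℤ}
    (h : GameStep G.firingMatrix (fun j ↦ c (some j)) y) :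
    ∃ c', G.Step none c c' ∧ (fun j ↦ c' (some j)) = y ∧ ∑ v, c' v = ∑ v, c v := by
  rcases h with ⟨i, hi, rfl⟩ | ⟨hs, rfl⟩
  · exact ⟨_, ⟨some i, by simpa [CanFire, firingMatrix] using hi, rfl⟩, fire_some_comp c i,
      sum_fire _ _⟩
  · exact ⟨_, ⟨none, by simpa [CanFire] using (isStable_iff c).2 hs, rfl⟩, fire_none_comp hb c,
      sum_fire _ _⟩

lemma exists_transGen_of_gameStep {c : Option V → ℤ} {x y : V → ℤ}
    (hx : (fun j ↦ c (some j)) = x) (h : TransGen (GameStep G.firingMatrix) x y) :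
    ∃ c', TransGen (G.Step none) c c' ∧ (fun j ↦ c' (some j)) = y ∧ ∑ v, c' v = ∑ v, c v := by
  subst hx
  induction h with
  | single h =>
    obtain ⟨c', hc, hc'⟩ := exists_step_of_gameStep hb h
    exact ⟨c', .single hc, hc'⟩
  | tail _ h ih =>
    obtain ⟨c', hc, rfl, hsum⟩ := ih
    obtain ⟨c'', hc', hy, hsum'⟩ := exists_step_of_gameStep hb h
    exact ⟨c'', hc.tail hc', hy, hsum'.trans hsum⟩

/-- The holding of the bank is recovered from the others because firing preserves the total. -/
lemma isRecurrent_iff (c : Option V → ℤ) :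
    G.IsRecurrent none c ↔
      TransGen (GameStep G.firingMatrix) (fun j ↦ c (some j)) fun j ↦ c (some j) := by
  constructor
  · intro h
    exact TransGen.lift (fun c : Option V → ℤ ↦ fun j ↦ c (some j))
      (fun _ _ h ↦ Step.gameStep hb h) _ _ h
  · intro h
    obtain ⟨c', hc, hc', hsum⟩ := exists_transGen_of_gameStep hb rfl h
    have : c' = c := by
      funext v
      cases v with
      | some v => exact congr_fun hc' v
      | none =>
        rw [Fintype.sum_option, Fintype.sum_option] at hsum
        have h2 : ∑ i, c' (some i) = ∑ i, c (some i) := Finset.sum_congr rfl fun i _ ↦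
          congr_fun hc' i
        linarith
    rwa [this] at hc

lemma isCritical_iff (c : Option V → ℤ) :
    G.IsCritical none c ↔ IsCrit G.firingMatrix (fun j ↦ c (some j)) ∧
      c none = -∑ j, c (some j) := by
  rw [IsCritical, IsCrit, isStable_iff, isRecurrent_iff hb, IsConfig, Fintype.sum_option,
    eq_neg_iff_add_eq_zero]
  have : (∀ i, i ≠ none → 0 ≤ c i) ↔ 0 ≤ fun j ↦ c (some j) := by
    simp [Option.forall, Pi.le_def]
  rw [this]
  tauto

theorem card_criticalGroup (hG : IsFiringMatrix G.firingMatrix) :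
    Nat.card (G.CriticalGroup none) = (Matrix.of G.firingMatrix).det.natAbs := by
  rw [← card_isCrit hG]
  refine Nat.card_congr (Equiv.ofBijective
    (fun c ↦ ⟨fun j ↦ c.1 (some j), ((isCritical_iff hb c.1).1 c.2).1⟩) ⟨?_, ?_⟩)
  · intro c c' h
    have h1 : (fun j ↦ c.1 (some j)) = fun j ↦ c'.1 (some j) := congr_arg Subtype.val h
    refine Subtype.ext (funext fun v ↦ ?_)
    cases v with
    | some v => exact congr_fun h1 v
    | none =>
      rw [((isCritical_iff hb c.1).1 c.2).2, ((isCritical_iff hb c'.1).1 c'.2).2]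
      exact congr_arg Neg.neg (Finset.sum_congr rfl fun i _ ↦ congr_fun h1 i)
  · rintro ⟨x, hx⟩
    exact ⟨⟨fun v ↦ v.elim (-∑ j, x j) x, (isCritical_iff hb _).2 ⟨hx, rfl⟩⟩, rfl⟩

end MultiDigraph

/-! ### The determinant of the wheel. -/

section Wheel

open MultiDigraph ChipFiring

variable (k q t : ℕ) [NeZero k]

/-- The formula also covers `k = 1` and `k = 2`, where neighbours coincide: for `k = 1` the loop
terms cancel and leave `t`. -/
lemma wheel_firingMatrix (i j : ZMod k) :
    (wheel k q t).firingMatrix i j = (if j = i then (1 + q + t : ℤ) else 0) -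
      (if j = i - 1 then 1 else 0) - if j = i + 1 then (q : ℤ) else 0 := by
  rw [firingMatrix]
  by_cases h : j = i
  · subst h
    rw [if_pos rfl, if_pos rfl, outDegree]
    push_cast
    rw [Finset.sum_erase_eq_sub (Finset.mem_univ _), Fintype.sum_option]
    simp only [wheel]
    push_cast
    rw [Finset.sum_add_distrib, Finset.sum_ite_eq', Finset.sum_ite_eq', if_pos (Finset.mem_univ _),
      if_pos (Finset.mem_univ _)]
    ring
  · rw [if_neg h, if_neg h]
    simp only [wheel]
    push_cast
    ring

lemma sum_wheel_firingMatrix (j : ZMod k) : (∑ i, (wheel k q t).firingMatrix i) j = t := by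
  rw [Finset.sum_apply]
  simp only [wheel_firingMatrix, Finset.sum_sub_distrib]
  have h1 : ∀ i, j = i - 1 ↔ j + 1 = i := fun i ↦ eq_sub_iff_add_eq
  have h2 : ∀ i, j = i + 1 ↔ j - 1 = i := fun i ↦ sub_eq_iff_eq_add.symm
  simp only [h1, h2, Finset.sum_ite_eq, Finset.mem_univ, if_true]
  ring

lemma isFiringMatrix_wheel (ht : 1 ≤ t) : IsFiringMatrix (wheel k q t).firingMatrix where
  nonpos i j hij := by
    rw [firingMatrix, if_neg hij.symm]
    simp
  leak i := by
    simp only [wheel_firingMatrix, Finset.sum_sub_distrib, Finset.sum_ite_eq', Finset.mem_univ,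
      if_true]
    lia
  sum_pos j := by
    rw [sum_wheel_firingMatrix]
    lia

/-- The matrix of the cyclic shift. -/
def cyclicShift (R : Type*) [CommRing R] : Matrix (ZMod k) (ZMod k) R :=
  Matrix.of fun i j ↦ if j = i - 1 then 1 else 0

lemma cyclicShift_mul {R : Type*} [CommRing R] (M : Matrix (ZMod k) (ZMod k) R) (i j : ZMod k) :
    (cyclicShift k R * M) i j = M (i - 1) j := by
  simp [Matrix.mul_apply, cyclicShift]

lemma cyclicShift_pow {R : Type*} [CommRing R] (n : ℕ) (i j : ZMod k) :
    (cyclicShift k R ^ n) i j = if j = i - n then 1 else 0 := by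
  induction n generalizing i with
  | zero => simp [Matrix.one_apply, eq_comm]
  | succ n ih =>
    rw [pow_succ', cyclicShift_mul, ih, Nat.cast_succ, sub_sub, add_comm (1 : ZMod k)]

omit [NeZero k] in
lemma cyclicShift_apply {R : Type*} [CommRing R] (i j : ZMod k) :
    cyclicShift k R i j = if j = i - 1 then 1 else 0 :=
  rfl

open Polynomial

lemma cyclicShift_pow_card {R : Type*} [CommRing R] : cyclicShift k R ^ k = 1 := by
  ext i j
  rw [cyclicShift_pow, Matrix.one_apply, ZMod.natCast_self, sub_zero]
  exact if_congr eq_comm rfl rfl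

/-- The powers of the shift below `k` have disjoint supports, so row `0` displays the coefficients
of `p`. Hence no nonzero polynomial of degree less than `k` annihilates the shift. -/
lemma aeval_cyclicShift_apply {R : Type*} [CommRing R] {p : R[X]} (hp : p.natDegree < k) {m : ℕ}
    (hm : m < k) : aeval (cyclicShift k R) p 0 (-(m : ZMod k)) = p.coeff m := by
  rw [aeval_eq_sum_range' hp, Matrix.sum_apply, Finset.sum_eq_single m]
  · rw [Matrix.smul_apply, cyclicShift_pow, zero_sub, if_pos rfl, smul_eq_mul, mul_one]
  · intro n hn hnm
    rw [Finset.mem_range] at hn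
    rw [Matrix.smul_apply, cyclicShift_pow, zero_sub, if_neg, smul_zero]
    intro h
    rw [neg_inj, ZMod.natCast_eq_natCast_iff', Nat.mod_eq_of_lt hm, Nat.mod_eq_of_lt hn] at h
    exact hnm h.symm
  · intro h
    exact (h (Finset.mem_range.2 hm)).elim

lemma minpoly_cyclicShift (K : Type*) [Field K] : X ^ k - 1 = minpoly K (cyclicShift k K) := by
  have hk : k ≠ 0 := NeZero.ne k
  have hmon : (X ^ k - 1 : K[X]).Monic := monic_X_pow_sub_C (1 : K) hk
  have hdeg : (X ^ k - 1 : K[X]).degree = k := degree_X_pow_sub_C (NeZero.pos k) (1 : K)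
  refine minpoly.unique' K _ hmon ?_ fun p hp ↦ ?_
  · rw [map_sub, map_pow, aeval_X, map_one, cyclicShift_pow_card, sub_self]
  · rw [or_iff_not_imp_right, not_not]
    intro h0
    rw [hdeg] at hp
    by_contra hp0
    have hpk : p.natDegree < k := (natDegree_lt_iff_degree_lt hp0).2 hp
    have h1 := aeval_cyclicShift_apply k hpk hpk
    rw [h0, Matrix.zero_apply] at h1
    exact hp0 (leadingCoeff_eq_zero.1 h1.symm)

lemma charpoly_cyclicShift (K : Type*) [Field K] : (cyclicShift k K).charpoly = X ^ k - 1 := by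
  have hmon : (X ^ k - 1 : K[X]).Monic := monic_X_pow_sub_C (1 : K) (NeZero.ne k)
  have hdeg : (X ^ k - 1 : K[X]).natDegree = k := natDegree_X_pow_sub_C (r := (1 : K))
  refine eq_of_monic_of_dvd_of_natDegree_le hmon (Matrix.charpoly_monic _) ?_ ?_
  · rw [minpoly_cyclicShift]
    exact Matrix.minpoly_dvd_charpoly _
  · rw [Matrix.charpoly_natDegree_eq_dim, ZMod.card, hdeg]

/-- With `P` the shift, the Laplacian is `(1 + q + t) - P - q P⁻¹`; multiplying by `-P` gives a
quadratic in `P` with roots `α` and `β`. -/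
lemma neg_cyclicShift_mul_wheel {α β : ℂ} (h1 : α + β = 1 + q + t) (h2 : α * β = q) :
    -cyclicShift k ℂ * (Matrix.of (wheel k q t).firingMatrix).map (Int.castRingHom ℂ) =
      (Matrix.scalar _ α - cyclicShift k ℂ) * (Matrix.scalar _ β - cyclicShift k ℂ) := by
  have h3 : (Matrix.scalar (ZMod k) α - cyclicShift k ℂ) * (Matrix.scalar _ β - cyclicShift k ℂ) =
      (α * β) • (1 : Matrix _ _ ℂ) - (α + β) • cyclicShift k ℂ + cyclicShift k ℂ ^ 2 := by
    simp only [Matrix.scalar_apply, ← Matrix.smul_one_eq_diagonal, sub_mul, mul_sub, smul_mul_assoc,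
      mul_smul_comm, one_mul, mul_one, add_smul, sq, smul_sub, mul_smul]
    rw [smul_comm β α (1 : Matrix (ZMod k) (ZMod k) ℂ)]
    abel
  rw [h3, h1, h2]
  ext i j
  have e1 : i - 1 - 1 = i - (2 : ℕ) := by push_cast; ring
  have e2 : (1 : Matrix (ZMod k) (ZMod k) ℂ) i j = if j = i then 1 else 0 := by
    rw [Matrix.one_apply]
    exact if_congr eq_comm rfl rfl
  rw [neg_mul, Matrix.neg_apply, cyclicShift_mul]
  simp only [Matrix.map_apply, Matrix.of_apply, wheel_firingMatrix, Matrix.add_apply,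
    Matrix.sub_apply, Matrix.smul_apply, cyclicShift_pow, e2, cyclicShift_apply,
    eq_intCast, smul_eq_mul, sub_add_cancel, e1]
  push_cast
  simp only [mul_ite, mul_one, mul_zero]
  ring

lemma det_wheel : (Matrix.of (wheel k q t).firingMatrix).det =
    powerSumSeq (1 + q + t : ℤ) q k - 1 - (q : ℤ) ^ k := by
  obtain ⟨α, β, h1, h2⟩ : ∃ α β : ℂ, α + β = 1 + q + t ∧ α * β = q := by
    obtain ⟨s, hs⟩ := IsAlgClosed.exists_pow_nat_eq ((1 + q + t : ℂ) ^ 2 - 4 * q) two_pos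
    exact ⟨(1 + q + t + s) / 2, (1 + q + t - s) / 2, by ring, by linear_combination -hs / 4⟩
  have hdet : ∀ z : ℂ, (Matrix.scalar _ z - cyclicShift k ℂ).det = z ^ k - 1 := fun z ↦ by
    rw [← Matrix.eval_charpoly, charpoly_cyclicShift]
    simp
  have hdetP : (-cyclicShift k ℂ).det = -1 := by
    have := hdet 0
    rwa [map_zero, zero_sub, zero_pow (NeZero.ne k), zero_sub] at this
  have h4 := congr_arg Matrix.det (neg_cyclicShift_mul_wheel k q t h1 h2)
  rw [Matrix.det_mul, Matrix.det_mul, hdetP, hdet, hdet, ← RingHom.mapMatrix_apply,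
    ← RingHom.map_det] at h4
  have h5 := powerSumSeq_eq α β k
  rw [h1, h2] at h5
  have h6 := map_powerSumSeq (Int.castRingHom ℂ) (1 + q + t) q k
  simp only [eq_intCast, Int.cast_add, Int.cast_one, Int.cast_natCast] at h6 h4
  rw [h5] at h6
  have h7 : α ^ k * β ^ k = (q : ℂ) ^ k := by rw [← mul_pow, h2]
  apply Int.cast_injective (α := ℂ)
  rw [Int.cast_sub, Int.cast_sub, Int.cast_one, Int.cast_pow, Int.cast_natCast]
  linear_combination -h4 - h6 - h7

/-- Nonnegativity removes the absolute value from the determinant; monotonicity is carried along to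
make the induction work. -/
lemma powerSumSeq_sub_nonneg_and_le (n : ℕ) :
    0 ≤ powerSumSeq (1 + q + t : ℤ) q n - 1 - (q : ℤ) ^ n ∧
      powerSumSeq (1 + q + t : ℤ) q n - 1 - (q : ℤ) ^ n ≤
        powerSumSeq (1 + q + t : ℤ) q (n + 1) - 1 - (q : ℤ) ^ (n + 1) := by
  induction n with
  | zero =>
    simp [powerSumSeq]
    lia
  | succ n ih =>
    obtain ⟨h1, h2⟩ := ih
    refine ⟨h1.trans h2, ?_⟩
    rw [powerSumSeq]
    set u := powerSumSeq (1 + q + t : ℤ) q n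
    set v := powerSumSeq (1 + q + t : ℤ) q (n + 1)
    have h3 : 0 ≤ (q : ℤ) * (v - 1 - (q : ℤ) ^ (n + 1) - (u - 1 - (q : ℤ) ^ n)) :=
      mul_nonneg (Int.natCast_nonneg q) (by linarith)
    have h4 : 0 ≤ (t : ℤ) * (v - 1 - (q : ℤ) ^ (n + 1)) :=
      mul_nonneg (Int.natCast_nonneg t) (by linarith)
    have h5 : 0 ≤ (t : ℤ) * (1 + (q : ℤ) ^ (n + 1)) := by positivity
    nlinarith [pow_succ (q : ℤ) n, pow_succ (q : ℤ) (n + 1)]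

theorem card_criticalGroup_wheel (ht : 1 ≤ t) :
    (Nat.card ((wheel k q t).CriticalGroup none) : ℤ) =
      powerSumSeq (1 + q + t : ℤ) q k - 1 - (q : ℤ) ^ k := by
  rw [card_criticalGroup (fun j ↦ by rw [sum_wheel_firingMatrix]; rfl)
    (isFiringMatrix_wheel k q t ht), det_wheel, Int.natAbs_of_nonneg (powerSumSeq_sub_nonneg_and_le q t k).1]

end Wheel

/-- For `k ≥ 1` there is exactly one polynomial `N_k(q, N₁)` expressing `#E(𝔽_{q^k})` through `q`
and `N₁ = #E(𝔽_q)`, and the critical group of the `(q,t)`-wheel multidigraph `W_k(q,t)` with the hub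
as bank has order `-N_k(q, -t)`, for all integers `q ≥ 0` and `t ≥ 1`. -/
theorem theorem4 (k : ℕ) [NeZero k] :
    (∃! N : MvPolynomial (Fin 2) ℤ, ExpressesPointCount k N) ∧
    ∀ N : MvPolynomial (Fin 2) ℤ, ExpressesPointCount k N →
      ∀ q t : ℕ, 1 ≤ t →
        (Nat.card ((wheel k q t).CriticalGroup none) : ℤ) =
          -MvPolynomial.eval ![(q : ℤ), -(t : ℤ)] N := by
  refine ⟨existsUnique_expressesPointCount k, fun N hN q t ht ↦ ?_⟩
  -- Substituting `-t` for `N₁` turns the trace `1 + q - N₁` into `1 + q + t`.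
  rw [expressesPointCount_unique hN (expressesPointCount_pointCountPolynomial k),
    eval_pointCountPolynomial, card_criticalGroup_wheel k q t ht, sub_neg_eq_add]
  ring
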